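/- Consider the Schrödinger equation on the circle $\mathbb R/\mathbb Z$ (that is, on $[0,1]$ with periodic boundary conditions) $$\mathrm i\,\partial_t\phi(t,x)=-f_1(t)\,\partial_x^2\phi(t,x)+f_2(t)V(x)\phi(t,x),\qquad f_1=\frac1{2M},\quad f_2=\frac{M\omega^2}{2},\qquad t\in[0,T],$$ where $M,\omega\in C^2([0,T])$ are real functions with $M\ge m>0$ and $|M^{(j)}|,|\omega^{(j)}|\le K$ on $[0,T]$ for $j\le 2$, and $V$ is a real $1$-periodic $C^4$ function with $|V^{(j)}|\le K$ for $j\le4$. For $n\ge1$ let $H_1$ be the $n\times n$ periodic central-difference matrix, $(H_1v)_k=n^2(2v_k-v_{k+1}-v_{k-1})$ with indices modulo $n$, and let $H_2=\mathrm{diag}(V(k/n))_{k=0}^{n-1}$. Let $U(t,0)$ be the evolution operator of $\mathrm i\,\partial_tU(t,0)=(f_1(t)H_1+f_2(t)H_2)U(t,0)$, $U(0,0)=I$. Define the single steps $$\begin{aligned} U_{s,1}(t+h,t)&=e^{-\mathrm i hf_2(t+h)H_2}\,e^{-\mathrm i hf_1(t+h)H_1},\\ U_{g,1}(t+h,t)&=e^{-\mathrm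 i\int_t^{t+h}f_2(s)ds\,H_2}\,e^{-\mathrm i\int_t^{t+h}f_1(s)ds\,H_1},\\ U_{s,2}(t+h,t)&=e^{-\frac{\mathrm i h}{2}f_1(t+h/2)H_1}\,e^{-\mathrm i hf_2(t+h/2)H_2}\,e^{-\frac{\mathrm i h}{2}f_1(t+h/2)H_1},\\ U_{g,2}(t+h,t)&=e^{-\mathrm i\int_{t+h/2}^{t+h}f_1(s)ds\,H_1}\,e^{-\mathrm i\int_t^{t+h}f_2(s)ds\,H_2}\,e^{-\mathrm i\int_t^{t+h/2}f_1(s)ds\,H_1}, \end{aligned}$$ of the standard ($s$) and generalized ($g$) Trotter formulae of order $p=1,2$. For $h=T/L$ let $U_{\ast,p}(T,0)=U_{\ast,p}(Lh,(L-1)h)\cdots U_{\ast,p}(2h,h)\,U_{\ast,p}(h,0)$ be the numerical evolution operator with $L$ equidistant time steps ($\ast\in\{s,g\}$). Let $\|\cdot\|$ denote the spectral norm of matrices and $\|v\|_\star=n^{-1/2}\big(\sum_k|v_k|^2\big)^{1/2}$ the rescaled 2-norm of vectors. **Lemma.** There are constants $\widetilde C,c>0$ depending only on $m$ and $K$ (so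 independent of $T,L,n,\phi,\vec\psi$) such that for all $T>0$, all $M,\omega,V$ as above, all $n\ge1$ and all sufficiently many time steps, namely $L\ge cT$, the following hold. 1. (Operator norm.) $$\begin{aligned} \|U_{s,1}(T,0)-U(T,0)\|&\le\widetilde C\,\frac{n^2T^2}{L},&\|U_{g,1}(T,0)-U(T,0)\|&\le\widetilde C\,\frac{nT^2}{L},\\ \|U_{s,2}(T,0)-U(T,0)\|&\le\widetilde C\,\frac{n^2T^3}{L^2},&\|U_{g,2}(T,0)-U(T,0)\|&\le\widetilde C\,\frac{n^2T^3}{L^2}. \end{aligned}$$ 2. (Vector norm.) Let $\phi$ be a classical solution of the Schrödinger equation above on $[0,T]$, $1$-periodic and $C^4$ in $x$, with $\partial_x^2\phi$ and $\partial_x^4\phi$ bounded. Let $\vec\psi$ solve $\mathrm i\,\vec\psi'(t)=(f_1(t)H_1+f_2(t)H_2)\vec\psi(t)$ on $[0,T]$ with $\vec\psi(0)=(\phi(0,k/n))_{k=0}^{n-1}$, and let $\vec\psi_{\ast,p}(T)=U_{\ast,p}(T,0)\vec\psi(0)$. Put $$S_4=\sup_{t\in[0,T],\,x\in[0,1]}|\partial_x^4\phi(t,x)|,\qquad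 S_2=\sup_{t\in[0,T],\,x\in[0,1]}|\partial_x^2\phi(t,x)|,\qquad S_0=\sup_{y\in[0,1]}|\phi(0,y)|.$$ Then $$\begin{aligned} \|\vec\psi_{s,1}(T)-\vec\psi(T)\|_\star&\le\widetilde C\,\frac{T^2}{L}\big((T+1)S_4+S_2+S_0\big),\\ \|\vec\psi_{g,1}(T)-\vec\psi(T)\|_\star&\le\widetilde C\,\frac{T^2}{L}\Big(\big((T+1)S_4+S_2\big)^{1/2}S_0^{1/2}+S_0\Big),\\ \|\vec\psi_{s,2}(T)-\vec\psi(T)\|_\star&\le\widetilde C\,\frac{T^3}{L^2}\big((T+1)S_4+S_2+S_0\big),\\ \|\vec\psi_{g,2}(T)-\vec\psi(T)\|_\star&\le\widetilde C\,\frac{T^3}{L^2}\big((T+1)S_4+S_2+S_0\big). \end{aligned}$$ -/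

import Mathlib

open scoped Matrix.Norms.L2Operator

noncomputable section

namespace TrotterFD

/-! ### Time-dependent Hamiltonians `f₁(t) A + f₂(t) B` and the Trotter steps from `t` to `t + h` -/

section Schemes

variable {n : ℕ}

/-- First-order standard Trotter step. -/
def stepS1 (f₁ f₂ : ℝ → ℝ) (A B : Matrix (Fin n) (Fin n) ℂ) (t h : ℝ) :
    Matrix (Fin n) (Fin n) ℂ :=
  NormedSpace.exp ((-Complex.I * (f₂ (t + h) : ℂ) * (h : ℂ)) • B) *
    NormedSpace.exp ((-Complex.I * (f₁ (t + h) : ℂ) * (h : ℂ)) • A)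

/-- First-order generalized Trotter step. -/
def stepG1 (f₁ f₂ : ℝ → ℝ) (A B : Matrix (Fin n) (Fin n) ℂ) (t h : ℝ) :
    Matrix (Fin n) (Fin n) ℂ :=
  NormedSpace.exp ((-Complex.I * ((∫ s in t..(t + h), f₂ s : ℝ) : ℂ)) • B) *
    NormedSpace.exp ((-Complex.I * ((∫ s in t..(t + h), f₁ s : ℝ) : ℂ)) • A)

/-- Second-order standard Trotter step. -/
def stepS2 (f₁ f₂ : ℝ → ℝ) (A B : Matrix (Fin n) (Fin n) ℂ) (t h : ℝ) :
    Matrix (Fin n) (Fin n) ℂ :=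
  NormedSpace.exp ((-Complex.I * (f₁ (t + h / 2) : ℂ) * ((h / 2 : ℝ) : ℂ)) • A) *
    NormedSpace.exp ((-Complex.I * (f₂ (t + h / 2) : ℂ) * (h : ℂ)) • B) *
    NormedSpace.exp ((-Complex.I * (f₁ (t + h / 2) : ℂ) * ((h / 2 : ℝ) : ℂ)) • A)

/-- Second-order generalized Trotter step. -/
def stepG2 (f₁ f₂ : ℝ → ℝ) (A B : Matrix (Fin n) (Fin n) ℂ) (t h : ℝ) :
    Matrix (Fin n) (Fin n) ℂ :=
  NormedSpace.exp ((-Complex.I * ((∫ s in (t + h / 2)..(t + h), f₁ s : ℝ) : ℂ)) • A) *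
    NormedSpace.exp ((-Complex.I * ((∫ s in t..(t + h), f₂ s : ℝ) : ℂ)) • B) *
    NormedSpace.exp ((-Complex.I * ((∫ s in t..(t + h / 2), f₁ s : ℝ) : ℂ)) • A)

/-- The time-ordered product of the first `l` steps of length `h`, starting at time `0`; later
steps stand on the left. -/
def iterateSteps (step : ℝ → ℝ → Matrix (Fin n) (Fin n) ℂ) (h : ℝ) :
    ℕ → Matrix (Fin n) (Fin n) ℂ
  | 0 => 1
  | l + 1 => step ((l : ℝ) * h) h * iterateSteps step h l

/-- The numerical evolution operator from `0` to `T` with `L` equidistant time steps. -/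
def numEvolution (step : ℝ → ℝ → Matrix (Fin n) (Fin n) ℂ) (T : ℝ) (L : ℕ) :
    Matrix (Fin n) (Fin n) ℂ :=
  iterateSteps step (T / L) L

/-- The Hamiltonian `H(t) = f₁(t) A + f₂(t) B`. -/
def hamiltonian (f₁ f₂ : ℝ → ℝ) (A B : Matrix (Fin n) (Fin n) ℂ) (t : ℝ) :
    Matrix (Fin n) (Fin n) ℂ :=
  (f₁ t : ℂ) • A + (f₂ t : ℂ) • B

/-- `U` is the evolution operator `t ↦ U(t, 0)` on `[0, T]`: `i U' = H U`, `U(0, 0) = 1`. -/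
structure IsEvolution (H : ℝ → Matrix (Fin n) (Fin n) ℂ) (T : ℝ)
    (U : ℝ → Matrix (Fin n) (Fin n) ℂ) : Prop where
  init : U 0 = 1
  deriv : ∀ t ∈ Set.Icc 0 T, HasDerivWithinAt U (-Complex.I • (H t * U t)) (Set.Icc 0 T) t

/-- `ψ` solves `i ψ' = H ψ` on `[0, T]`. -/
def SolvesODE (H : ℝ → Matrix (Fin n) (Fin n) ℂ) (T : ℝ) (ψ : ℝ → Fin n → ℂ) : Prop :=
  ∀ t ∈ Set.Icc 0 T, HasDerivWithinAt ψ (-Complex.I • (H t).mulVec (ψ t)) (Set.Icc 0 T) t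

/-- The rescaled 2-norm `n^{-1/2} ‖v‖₂`. -/
def starNorm (v : Fin n → ℂ) : ℝ :=
  ‖WithLp.toLp 2 v‖ / √(n : ℝ)

end Schemes

/-! ### The finite-difference model on the `n` nodes `k / n` of the circle `ℝ / ℤ` -/

/-- The periodic central-difference discretization of `-∂ₓ²`. Addition in `Fin n` is modulo `n`. -/
def fdLaplacian (n : ℕ) [NeZero n] : Matrix (Fin n) (Fin n) ℂ :=
  ((n : ℂ) ^ 2) • Matrix.of fun i j =>
    (if i = j then 2 else 0) - (if j = i + 1 then 1 else 0) - (if i = j + 1 then 1 else 0)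

/-- Values of a function at the grid points `k / n`, `0 ≤ k ≤ n - 1`. -/
def sample (n : ℕ) {α : Type} (u : ℝ → α) : Fin n → α :=
  fun k => u ((k : ℕ) / (n : ℝ))

/-- The discretized potential. -/
def fdPotential (n : ℕ) (V : ℝ → ℝ) : Matrix (Fin n) (Fin n) ℂ :=
  Matrix.diagonal (sample n fun x => (V x : ℂ))

/-- The control function of the kinetic part, `1 / (2 M)`. -/
def kineticControl (M : ℝ → ℝ) (t : ℝ) : ℝ := 1 / (2 * M t)

/-- The control function of the potential part, `M ω² / 2`. -/
def potentialControl (M ω : ℝ → ℝ) (t : ℝ) : ℝ := M t * ω t ^ 2 / 2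

/-- `g` is twice continuously differentiable on `[0, T]`, and `|g|, |g'|, |g''| ≤ K` there. -/
def BoundedC2 (K T : ℝ) (g : ℝ → ℝ) : Prop :=
  ContDiffOn ℝ 2 g (Set.Icc 0 T) ∧
    ∀ j : ℕ, j ≤ 2 → ∀ t ∈ Set.Icc 0 T, |iteratedDerivWithin j g (Set.Icc 0 T) t| ≤ K

/-- `V` is a four times continuously differentiable function on the circle `ℝ / ℤ`, bounded by
`K` together with its derivatives up to order four. -/
def BoundedPeriodicC4 (K : ℝ) (V : ℝ → ℝ) : Prop :=
  Function.Periodic V 1 ∧ ContDiff ℝ 4 V ∧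
    ∀ j : ℕ, j ≤ 4 → ∀ x : ℝ, |iteratedDeriv j V x| ≤ K

/-- `φ t x` is a classical solution on `[0, T]`, with periodic boundary conditions in `x`, of
`i ∂ₜφ = -f₁(t) ∂ₓ²φ + f₂(t) V(x) φ`. It is four times continuously differentiable in `x`, and its
second and fourth derivatives in `x` are bounded, so that their suprema are finite. -/
structure IsExactSolution (f₁ f₂ V : ℝ → ℝ) (T : ℝ) (φ : ℝ → ℝ → ℂ) : Prop where
  periodic : ∀ t ∈ Set.Icc 0 T, Function.Periodic (φ t) 1
  contDiff : ∀ t ∈ Set.Icc 0 T, ContDiff ℝ 4 (φ t)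
  equation : ∀ t ∈ Set.Icc 0 T, ∀ x : ℝ,
    HasDerivWithinAt (fun s => φ s x)
      (-Complex.I * (-(f₁ t : ℂ) * iteratedDeriv 2 (φ t) x + (f₂ t : ℂ) * (V x : ℂ) * φ t x))
      (Set.Icc 0 T) t
  bdd_two : BddAbove
    ((fun p : ℝ × ℝ => ‖iteratedDeriv 2 (φ p.1) p.2‖) '' (Set.Icc 0 T ×ˢ Set.Icc 0 1))
  bdd_four : BddAbove
    ((fun p : ℝ × ℝ => ‖iteratedDeriv 4 (φ p.1) p.2‖) '' (Set.Icc 0 T ×ˢ Set.Icc 0 1))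

/-- `sup |∂ₓʲ φ(t, x)|` over `t ∈ [0, T]`, `x ∈ [0, 1]`. -/
def supDeriv (j : ℕ) (T : ℝ) (φ : ℝ → ℝ → ℂ) : ℝ :=
  sSup ((fun p : ℝ × ℝ => ‖iteratedDeriv j (φ p.1) p.2‖) '' (Set.Icc 0 T ×ˢ Set.Icc 0 1))

/-- `sup |u(y)|` over `y ∈ [0, 1]`. -/
def supUnit (u : ℝ → ℂ) : ℝ :=
  sSup ((fun y => ‖u y‖) '' Set.Icc 0 1)

end TrotterFD

end

namespace TrotterFD

/-! Let `A` and `B` be the discrete Laplacian and potential, `S` the cyclic shift and `D = n (S -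
1)`, so that `A = D* D`. As for differential operators, commuting with a smooth potential lowers the
order: uniformly in `n`, `[A, B]` is controlled by `D`, `[A, [A, B]]` by `A`, and `[B, [B, A]]` is
bounded (`CommutatorBounds`, proved in `commutatorBounds_fd`). Moreover `‖D v‖² ≤ ‖A v‖ ‖v‖`.

Local errors. A generalized step, seen as a function of its endpoint, satisfies the exact evolution
equation up to a residual. Since the Hamiltonian is self-adjoint, the error is at most the residual
times the step length (`norm_sub_le_of_residual`). At first order the residual is a single
commutator `[B, A]`, of size `τ ‖D v‖`; interpolation then yields the square root in the bound for
`g,1`. For the symmetric splitting the first-order commutator terms cancel up to `O(τ²)`, leaving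
double commutators of size `τ² ‖A v‖` (`norm_strang_residual_le`). A standard step is a generalized
one with quadrature errors in the exponents: endpoint rule `O(τ²)`, midpoint rule `O(τ³)`.

Global errors. All steps are unitary, so local errors add up. They are evaluated on the exact
semi-discrete solution `ψ`, hence only `‖A ψ(t)‖` has to be bounded
(`norm_numEvolution_sub_le_all`). For the operator norm, `‖A‖ ≤ 4 n²` suffices. For the vector norm,
`ψ` is compared with the sampled solution `φ`: their distance is `O(n⁻²)` by consistency of the
difference scheme, which absorbs the factor `4 n²` (`norm_fdLaplacian_solution_le`). -/

theorem norm_sub_le_of_hasDerivAt {F : Type*} [NormedAddCommGroup F] [NormedSpace ℝ F]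
    {f f' : ℝ → F} {M r : ℝ}
    (hf : ∀ x, HasDerivAt f (f' x) x) (hM : ∀ x, |x| ≤ |r| → ‖f' x‖ ≤ M) :
    ‖f r - f 0‖ ≤ M * |r| := by
  have := Convex.norm_image_sub_le_of_norm_hasDerivWithin_le (s := Set.uIcc 0 r) (f := f)
    (x := 0) (y := r) (fun x _ => (hf x).hasDerivWithinAt)
    (fun x hx => hM x (by simpa using Set.abs_sub_left_of_mem_uIcc hx)) (convex_uIcc 0 r)
    Set.left_mem_uIcc Set.right_mem_uIcc
  simpa using this

/-! ### Unitary groups, the energy estimate, and Taylor expansion of conjugated operators. -/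

section Propagator

variable {E : Type*} [NormedAddCommGroup E] [InnerProductSpace ℂ E] [CompleteSpace E]

/-- The unitary group `r ↦ exp (-i r X)` generated by `X`. -/
noncomputable def propagator (X : E →L[ℂ] E) (r : ℝ) : E →L[ℂ] E :=
  NormedSpace.exp ((-Complex.I * (r : ℂ)) • X)

theorem propagator_zero (X : E →L[ℂ] E) : propagator X 0 = 1 := by
  simp [propagator]

theorem propagator_add (X : E →L[ℂ] E) (r s : ℝ) :
    propagator X (r + s) = propagator X r * propagator X s := by
  let : NormedAlgebra ℚ (E →L[ℂ] E) := NormedAlgebra.restrictScalars ℚ ℂ _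
  unfold propagator
  rw [← NormedSpace.exp_add_of_commute]
  · congr 1
    rw [← add_smul]
    push_cast
    ring_nf
  · exact ((Commute.refl X).smul_left _).smul_right _

theorem propagator_add_apply (X : E →L[ℂ] E) (r s : ℝ) (v : E) :
    propagator X (r + s) v = propagator X r (propagator X s v) := by
  rw [propagator_add]; rfl

theorem propagator_neg_apply_self (X : E →L[ℂ] E) (r : ℝ) (v : E) :
    propagator X (-r) (propagator X r v) = v := by
  rw [← propagator_add_apply, neg_add_cancel, propagator_zero]; rfl

theorem norm_propagator_apply {X : E →L[ℂ] E} (hX : IsSelfAdjoint X) (r : ℝ) (v : E) :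
    ‖propagator X r v‖ = ‖v‖ := by
  let : NormedAlgebra ℚ (E →L[ℂ] E) := NormedAlgebra.restrictScalars ℚ ℂ _
  apply ContinuousLinearMap.norm_map_of_mem_unitary
  unfold propagator
  apply NormedSpace.exp_mem_unitary_of_mem_skewAdjoint
  rw [skewAdjoint.mem_iff, star_smul, hX.star_eq]
  simp

theorem commute_propagator {X Y : E →L[ℂ] E} (h : Commute X Y) (r : ℝ) :
    Commute (propagator X r) Y := by
  unfold propagator
  exact (h.smul_left _).exp_left

theorem commute_propagator_apply {X Y : E →L[ℂ] E} (h : Commute X Y) (r : ℝ) (v : E) :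
    Y (propagator X r v) = propagator X r (Y v) :=
  (DFunLike.congr_fun (commute_propagator h r).eq v).symm

theorem propagator_apply_self (X : E →L[ℂ] E) (r : ℝ) (v : E) :
    X (propagator X r v) = propagator X r (X v) :=
  commute_propagator_apply (Commute.refl X) r v

theorem hasDerivAt_propagator (X : E →L[ℂ] E) (r : ℝ) :
    HasDerivAt (propagator X) (-Complex.I • (X * propagator X r)) r := by
  have h := hasDerivAt_exp_smul_const' X (-Complex.I * (r : ℂ))
  have h2 : HasDerivAt (fun r : ℝ => -Complex.I * (r : ℂ)) (-Complex.I) r := by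
    simpa using (Complex.ofRealCLM.hasDerivAt (x := r)).const_mul (-Complex.I)
  exact h.scomp r h2

/-- Product rule with a variable exponent; nesting it differentiates a splitting product with any
number of exponentials. -/
theorem hasDerivAt_propagator_comp_apply (X : E →L[ℂ] E) {a : ℝ → ℝ} {a' : ℝ} {w : ℝ → E} {w' : E}
    {x : ℝ} (ha : HasDerivAt a a' x) (hw : HasDerivAt w w' x) :
    HasDerivAt (fun x => propagator X (a x) (w x))
      (-Complex.I • (a' : ℂ) • X (propagator X (a x) (w x)) + propagator X (a x) w') x := by
  have h := (hasDerivAt_propagator X (a x)).scomp x ha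
  have h2 : HasDerivAt (fun x => (propagator X (a x)).restrictScalars ℝ)
      ((a' • (-Complex.I • (X * propagator X (a x)))).restrictScalars ℝ) x :=
    (ContinuousLinearMap.restrictScalarsL ℂ E E ℝ ℝ).hasFDerivAt.comp_hasDerivAt x h
  have h3 := h2.clm_apply hw
  refine h3.congr_deriv ?_
  simp only [ContinuousLinearMap.coe_restrictScalars']
  congr 1
  change a' • (-Complex.I • X (propagator X (a x) (w x))) = _
  rw [smul_comm, Complex.coe_smul]

/-- Energy estimate for `e' = -i H(t) e + g` with self-adjoint `H(t)`. -/
theorem norm_le_of_hasDerivWithinAt_selfAdjoint {H : ℝ → E →L[ℂ] E} {e g : ℝ → E} {a b r : ℝ}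
    (hab : a ≤ b) (hH : ∀ x ∈ Set.Icc a b, IsSelfAdjoint (H x))
    (he : ∀ x ∈ Set.Icc a b,
      HasDerivWithinAt e (-Complex.I • H x (e x) + g x) (Set.Icc a b) x)
    (hg : ∀ x ∈ Set.Icc a b, ‖g x‖ ≤ r) :
    ∀ x ∈ Set.Icc a b, ‖e x‖ ≤ ‖e a‖ + r * (x - a) := by
  have hr : 0 ≤ r := (norm_nonneg _).trans (hg a ⟨le_rfl, hab⟩)
  have hre : ∀ x ∈ Set.Icc a b,
      (inner ℂ (e x) (-Complex.I • H x (e x) + g x)).re ≤ r * ‖e x‖ := by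
    intro x hx
    rw [inner_add_right, inner_smul_right, Complex.add_re]
    have him : (inner ℂ (e x) (H x (e x))).im = 0 := by
      have hs := (ContinuousLinearMap.isSelfAdjoint_iff_isSymmetric.1 (hH x hx)) (e x) (e x)
      have hc := inner_conj_symm (𝕜 := ℂ) (e x) (H x (e x))
      have hs' : inner ℂ (H x (e x)) (e x) = inner ℂ (e x) (H x (e x)) := hs
      rw [hs'] at hc
      exact Complex.conj_eq_iff_im.1 hc
    have h1 : (-Complex.I * inner ℂ (e x) (H x (e x))).re = 0 := by
      simp [him]
    rw [h1, zero_add]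
    calc (inner ℂ (e x) (g x)).re ≤ ‖inner ℂ (e x) (g x)‖ := Complex.re_le_norm _
      _ ≤ ‖e x‖ * ‖g x‖ := norm_inner_le_norm _ _
      _ ≤ ‖e x‖ * r := by gcongr; exact hg x hx
      _ = r * ‖e x‖ := mul_comm _ _
  -- The squared norm is compared with a squared barrier, since `‖e‖` need not be differentiable at
  -- zeros of `e`. The slack `ε` keeps the barrier positive and makes the derivative inequality
  -- strict at contact points.
  have key : ∀ ε : ℝ, 0 < ε → ∀ x ∈ Set.Icc a b, ‖e x‖ ≤ ‖e a‖ + ε + (r + ε) * (x - a) := by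
    intro ε hε x hx
    have hd : ∀ x ∈ Set.Icc a b, HasDerivWithinAt (fun x => ‖e x‖ ^ 2)
        (2 * (inner ℂ (e x) (-Complex.I • H x (e x) + g x)).re) (Set.Icc a b) x := by
      intro x hx
      let := InnerProductSpace.complexToReal (G := E)
      exact (he x hx).norm_sq
    have hB : ∀ x : ℝ, HasDerivAt (fun x => (‖e a‖ + ε + (r + ε) * (x - a)) ^ 2)
        (2 * (‖e a‖ + ε + (r + ε) * (x - a)) * (r + ε)) x := by
      intro x
      have h := ((((hasDerivAt_id x).sub_const a).const_mul (r + ε)).const_add (‖e a‖ + ε)).pow 2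
      refine h.congr_deriv ?_
      simp
    have hpos : ∀ x ∈ Set.Icc a b, 0 < ‖e a‖ + ε + (r + ε) * (x - a) := by
      intro x hx
      have : 0 ≤ (r + ε) * (x - a) := mul_nonneg (by linarith) (by linarith [hx.1])
      linarith [norm_nonneg (e a)]
    have := image_le_of_deriv_right_lt_deriv_boundary
      (fun x hx => (hd x hx).continuousWithinAt)
      (fun x hx => (hd x (Set.Ico_subset_Icc_self hx)).mono_of_mem_nhdsWithin
        (Icc_mem_nhdsGE_of_mem hx))
      (by simp only [sub_self, mul_zero, add_zero]; gcongr; linarith) hB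
      (fun x hx heq => by
        have hx' := Set.Ico_subset_Icc_self hx
        have hp := hpos x hx'
        have hn : ‖e x‖ = ‖e a‖ + ε + (r + ε) * (x - a) :=
          (pow_left_inj₀ (norm_nonneg _) hp.le two_ne_zero).1 heq
        have h1 := hre x hx'
        rw [hn] at h1
        nlinarith [mul_pos hp hε]) hx
    exact (pow_le_pow_iff_left₀ (norm_nonneg _) (hpos x hx).le two_ne_zero).1 this
  intro x hx
  refine le_of_forall_pos_le_add fun η hη => ?_
  have hx0 : 0 ≤ x - a := by linarith [hx.1]
  have h := key (η / (1 + (x - a))) (by positivity) x hx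
  have h2 : η / (1 + (x - a)) * (1 + (x - a)) = η := div_mul_cancel₀ _ (by positivity)
  nlinarith

/-- The conjugate of `C` under the unitary group generated by `X`, applied to `v`. -/
noncomputable def conjApply (X C : E →L[ℂ] E) (v : E) (r : ℝ) : E :=
  propagator X r (C (propagator X (-r) v))

theorem conjApply_zero (X C : E →L[ℂ] E) (v : E) : conjApply X C v 0 = C v := by
  simp [conjApply, propagator_zero]

theorem norm_conjApply {X : E →L[ℂ] E} (hX : IsSelfAdjoint X) (C : E →L[ℂ] E) (v : E) (r : ℝ) :
    ‖conjApply X C v r‖ = ‖C (propagator X (-r) v)‖ :=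
  norm_propagator_apply hX _ _

theorem hasDerivAt_conjApply (X C : E →L[ℂ] E) (v : E) (r : ℝ) :
    HasDerivAt (conjApply X C v) (-Complex.I • conjApply X (X * C - C * X) v r) r := by
  have h1 := hasDerivAt_propagator_comp_apply X (hasDerivAt_neg r) (hasDerivAt_const r v)
  have h2 : HasDerivAt (fun r => C (propagator X (-r) v)) _ r :=
    (C.restrictScalars ℝ).hasFDerivAt.comp_hasDerivAt r h1
  refine (hasDerivAt_propagator_comp_apply X (hasDerivAt_id r) h2).congr_deriv ?_
  simp [conjApply, propagator_apply_self, sub_eq_add_neg]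

/-- The derivative of the conjugate is the conjugated commutator `[X, C]`. The commutator is bounded
only along the orbit of `v`: its operator norm may grow with `n`. -/
theorem norm_conjApply_sub_le {X : E →L[ℂ] E} (hX : IsSelfAdjoint X) {C : E →L[ℂ] E} {v : E}
    {M r : ℝ} (hM : ∀ x, |x| ≤ |r| → ‖(X * C - C * X) (propagator X x v)‖ ≤ M) :
    ‖conjApply X C v r - C v‖ ≤ M * |r| := by
  have := norm_sub_le_of_hasDerivAt (r := r) (hasDerivAt_conjApply X C v) (M := M) (fun x hx => by
    rw [norm_smul, norm_neg, Complex.norm_I, one_mul, norm_conjApply hX]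
    exact hM (-x) (by simpa using hx))
  rwa [conjApply_zero] at this

/-- One order further: the derivative of the left side is the zeroth-order remainder of `[X, C]`, so
the previous estimate applies with the double commutator. The factor 1/2 of Taylor's formula is
given away. -/
theorem norm_conjApply_sub_add_le {X : E →L[ℂ] E} (hX : IsSelfAdjoint X) {C : E →L[ℂ] E} {v : E}
    {M r : ℝ} (hM : ∀ x, |x| ≤ |r| →
      ‖(X * (X * C - C * X) - (X * C - C * X) * X) (propagator X x v)‖ ≤ M) :
    ‖conjApply X C v r - C v + Complex.I • (r : ℂ) • (X * C - C * X) v‖ ≤ M * r ^ 2 := by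
  have hM0 : 0 ≤ M := (norm_nonneg _).trans (hM 0 (by simp))
  have hd : ∀ x : ℝ, HasDerivAt
      (fun x : ℝ => conjApply X C v x + Complex.I • (x : ℂ) • (X * C - C * X) v)
      (-Complex.I • (conjApply X (X * C - C * X) v x - (X * C - C * X) v)) x := by
    intro x
    have h := (hasDerivAt_conjApply X C v x).add
      (((Complex.ofRealCLM.hasDerivAt (x := x)).smul_const ((X * C - C * X) v)).const_smul
        Complex.I)
    refine h.congr_deriv ?_
    simp [smul_sub]
    abel
  have := norm_sub_le_of_hasDerivAt (r := r) hd (M := M * |r|) (fun x hx => by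
    rw [norm_smul, norm_neg, Complex.norm_I, one_mul]
    refine (norm_conjApply_sub_le hX fun y hy => hM y (hy.trans hx)).trans ?_
    gcongr)
  simp only [conjApply_zero, Complex.ofReal_zero, zero_smul, smul_zero, add_zero] at this
  rw [mul_assoc, abs_mul_abs_self, ← pow_two] at this
  convert this using 2
  abel

end Propagator

/-! ### Regularity of the control functions and quadrature errors. -/

section Controls

/-- `f` is bounded and Lipschitz with constant `κ`, and on `[0, T]` it has first-order Taylor
expansions with quadratic remainder. -/
structure ControlBounds (f : ℝ → ℝ) (T κ : ℝ) : Prop where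
  abs_le : ∀ x, |f x| ≤ κ
  lipschitz : ∀ x y, |f x - f y| ≤ κ * |x - y|
  taylor : ∃ f' : ℝ → ℝ, ∀ x ∈ Set.Icc 0 T, ∀ y ∈ Set.Icc 0 T,
    |f x - f y - f' y * (x - y)| ≤ κ * (x - y) ^ 2

variable {f : ℝ → ℝ} {T κ : ℝ}

theorem ControlBounds.nonneg (hf : ControlBounds f T κ) : 0 ≤ κ :=
  (abs_nonneg _).trans (hf.abs_le 0)

theorem ControlBounds.continuous (hf : ControlBounds f T κ) : Continuous f := by
  have : LipschitzWith κ.toNNReal f := LipschitzWith.of_dist_le_mul fun x y => by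
    rw [Real.dist_eq, Real.dist_eq, Real.coe_toNNReal _ hf.nonneg]
    exact hf.lipschitz x y
  exact this.continuous

theorem ControlBounds.hasDerivAt_integral (hf : ControlBounds f T κ) (t x : ℝ) :
    HasDerivAt (fun x => ∫ s in t..x, f s) (f x) x :=
  (hf.continuous.integral_hasStrictDerivAt t x).hasDerivAt

theorem ControlBounds.abs_integral_le (hf : ControlBounds f T κ) {a b : ℝ} (hab : a ≤ b) :
    |∫ s in a..b, f s| ≤ κ * (b - a) := by
  have := intervalIntegral.norm_integral_le_of_norm_le_const (a := a) (b := b) (f := f) (C := κ)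
    fun x _ => hf.abs_le x
  rwa [abs_of_nonneg (sub_nonneg.2 hab)] at this

theorem ControlBounds.abs_integral_sub_le (hf : ControlBounds f T κ) {a b c : ℝ}
    (hc : c ∈ Set.Icc a b) : |(∫ s in a..b, f s) - (b - a) * f c| ≤ κ * (b - a) ^ 2 := by
  have hab : a ≤ b := hc.1.trans hc.2
  have h1 : (∫ s in a..b, f s) - (b - a) * f c = ∫ s in a..b, (f s - f c) := by
    rw [intervalIntegral.integral_sub (hf.continuous.intervalIntegrable _ _)
      (intervalIntegrable_const)]
    simp
  rw [h1]
  have := intervalIntegral.norm_integral_le_of_norm_le_const (a := a) (b := b)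
    (f := fun s => f s - f c) (C := κ * (b - a)) fun x hx => by
      rw [Set.uIoc_of_le hab] at hx
      refine (hf.lipschitz x c).trans (mul_le_mul_of_nonneg_left ?_ hf.nonneg)
      rw [_root_.abs_le]
      constructor <;> linarith [hx.1, hx.2, hc.1, hc.2]
  rw [abs_of_nonneg (sub_nonneg.2 hab)] at this
  calc _ ≤ _ := this
    _ = _ := by ring

/-- The linear Taylor term at the midpoint integrates to zero, which gains one order. Only this rule
uses `taylor`, hence the restriction to `[0, T]`. -/
theorem ControlBounds.abs_integral_sub_midpoint_le (hf : ControlBounds f T κ) {a b : ℝ}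
    (hab : a ≤ b) (ha : 0 ≤ a) (hb : b ≤ T) :
    |(∫ s in a..b, f s) - (b - a) * f ((a + b) / 2)| ≤ κ * (b - a) ^ 3 := by
  obtain ⟨f', hf'⟩ := hf.taylor
  set c := (a + b) / 2 with hc
  have h1 : (∫ s in a..b, f s) - (b - a) * f c = ∫ s in a..b, (f s - f c - f' c * (s - c)) := by
    have hi : ∫ s in a..b, f' c * (s - c) = 0 := by
      rw [intervalIntegral.integral_const_mul, intervalIntegral.integral_sub
        (continuous_id'.intervalIntegrable _ _) intervalIntegrable_const]
      simp only [integral_id, intervalIntegral.integral_const, smul_eq_mul, hc]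
      ring
    have i1 : IntervalIntegrable (fun s => f s - f c) MeasureTheory.volume a b :=
      (hf.continuous.sub continuous_const).intervalIntegrable _ _
    have i2 : IntervalIntegrable (fun s => f' c * (s - c)) MeasureTheory.volume a b :=
      (by fun_prop : Continuous fun s => f' c * (s - c)).intervalIntegrable _ _
    rw [intervalIntegral.integral_sub i1 i2, hi,
      intervalIntegral.integral_sub (hf.continuous.intervalIntegrable _ _)
      (intervalIntegrable_const)]
    simp
  rw [h1]
  have := intervalIntegral.norm_integral_le_of_norm_le_const (a := a) (b := b)
    (f := fun s => f s - f c - f' c * (s - c)) (C := κ * (b - a) ^ 2) fun x hx => by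
      rw [Set.uIoc_of_le hab] at hx
      refine (hf' x ⟨by linarith [hx.1], by linarith [hx.2]⟩ c
        ⟨by linarith, by linarith⟩).trans (mul_le_mul_of_nonneg_left ?_ hf.nonneg)
      apply sq_le_sq'
      · linarith [hx.1, hx.2]
      · linarith [hx.1, hx.2]
  rw [abs_of_nonneg (sub_nonneg.2 hab)] at this
  calc _ ≤ _ := this
    _ = _ := by ring

end Controls

/-! ### Stability of the orders under the flows, and first-order local errors. -/

section LocalErrors

variable {E : Type*} [NormedAddCommGroup E] [InnerProductSpace ℂ E] [CompleteSpace E]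

/-- Commutator bounds relative to a second-order operator `A` and its square root `D`. -/
structure CommutatorBounds (A B D : E →L[ℂ] E) (κ : ℝ) : Prop where
  selfAdjoint_left : IsSelfAdjoint A
  selfAdjoint_right : IsSelfAdjoint B
  one_le : 1 ≤ κ
  interpolation : ∀ v, ‖D v‖ ^ 2 ≤ ‖A v‖ * ‖v‖
  norm_right_le : ∀ v, ‖B v‖ ≤ κ * ‖v‖
  comm_right_sqrt : ∀ v, ‖(B * D - D * B) v‖ ≤ κ * ‖v‖
  comm : ∀ v, ‖(B * A - A * B) v‖ ≤ κ * (‖D v‖ + ‖v‖)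
  comm_left_comm : ∀ v,
    ‖(A * (A * B - B * A) - (A * B - B * A) * A) v‖ ≤ κ * (‖A v‖ + ‖v‖)
  comm_right_comm : ∀ v, ‖(B * (B * A - A * B) - (B * A - A * B) * B) v‖ ≤ κ * ‖v‖

/-- This converts a quadrature error in an exponent into an error of the step. -/
theorem norm_propagator_sub_le {X : E →L[ℂ] E} (hX : IsSelfAdjoint X) (r s : ℝ) (v : E) :
    ‖propagator X r v - propagator X s v‖ ≤ |r - s| * ‖X v‖ := by
  have h := norm_sub_le_of_hasDerivAt (r := r - s) (f := fun x => propagator X x v)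
    (f' := fun x => -Complex.I • propagator X x (X v)) (M := ‖X v‖) (fun x => by
      refine (hasDerivAt_propagator_comp_apply X (hasDerivAt_id x)
        (hasDerivAt_const x v)).congr_deriv ?_
      simp [propagator_apply_self]) (fun x _ => by
      rw [norm_smul, norm_neg, Complex.norm_I, one_mul, norm_propagator_apply hX])
  have h2 : propagator X r v - propagator X s v
      = propagator X s (propagator X (r - s) v - propagator X 0 v) := by
    rw [map_sub, ← propagator_add_apply, ← propagator_add_apply]
    simp
  rw [h2, norm_propagator_apply hX, mul_comm]
  exact h

variable {A B D : E →L[ℂ] E} {κ : ℝ}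

namespace CommutatorBounds

theorem norm_sqrt_le (h : CommutatorBounds A B D κ) (v : E) : ‖D v‖ ≤ ‖A v‖ + ‖v‖ := by
  have := h.interpolation v
  refine (pow_le_pow_iff_left₀ (norm_nonneg _) (by positivity) two_ne_zero).1 ?_
  nlinarith [norm_nonneg (A v), norm_nonneg v]

/-- Since `[B, D]` is bounded, the potential flow changes `‖D v‖` only by a multiple of `‖v‖`. -/
theorem norm_sqrt_propagator_le (h : CommutatorBounds A B D κ) (r : ℝ) (v : E) :
    ‖D (propagator B r v)‖ ≤ ‖D v‖ + κ * |r| * ‖v‖ := by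
  have h1 := norm_conjApply_sub_le (C := D) (v := v) (r := -r) (M := κ * ‖v‖) h.selfAdjoint_right
    fun x _ => (h.comm_right_sqrt _).trans_eq (by rw [norm_propagator_apply h.selfAdjoint_right])
  have h2 := norm_conjApply h.selfAdjoint_right D v (-r)
  rw [neg_neg] at h2
  rw [← h2]
  have h3 := norm_sub_norm_le (conjApply B D v (-r)) (D v)
  rw [abs_neg] at h1
  linarith

theorem norm_sqrt_add_propagator_le (h : CommutatorBounds A B D κ) {r : ℝ} (hr : |r| ≤ κ) (v : E) :
    ‖D (propagator B r v)‖ + ‖propagator B r v‖ ≤ 2 * κ ^ 2 * (‖D v‖ + ‖v‖) := by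
  have h1 := h.norm_sqrt_propagator_le r v
  have h2 : κ * |r| ≤ κ ^ 2 := by nlinarith [h.one_le]
  have h3 : 1 ≤ κ ^ 2 := one_le_pow₀ h.one_le
  rw [norm_propagator_apply h.selfAdjoint_right]
  nlinarith [mul_le_mul_of_nonneg_right h2 (norm_nonneg v), norm_nonneg (D v),
    mul_le_mul_of_nonneg_right h3 (norm_nonneg v), mul_le_mul_of_nonneg_right h3 (norm_nonneg (D v))]

theorem norm_conjApply_sub_le' (h : CommutatorBounds A B D κ) {r : ℝ} (hr : |r| ≤ κ) (v : E) :
    ‖conjApply B A v r - A v‖ ≤ 2 * κ ^ 3 * (‖D v‖ + ‖v‖) * |r| :=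
  norm_conjApply_sub_le h.selfAdjoint_right fun x hx => by
    refine (h.comm _).trans ?_
    calc _ ≤ κ * (2 * κ ^ 2 * (‖D v‖ + ‖v‖)) :=
          mul_le_mul_of_nonneg_left (h.norm_sqrt_add_propagator_le (hx.trans hr) v)
            (zero_le_one.trans h.one_le)
      _ = _ := by ring

/-- The graph norm of `A` is stable under the flow of `B` because `[B, A]` is only of first order,
hence dominated by that norm. -/
theorem norm_left_add_propagator_le (h : CommutatorBounds A B D κ) {r : ℝ} (hr : |r| ≤ κ) (v : E) :
    ‖A (propagator B r v)‖ + ‖propagator B r v‖ ≤ 5 * κ ^ 4 * (‖A v‖ + ‖v‖) := by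
  have h0 := h.one_le
  have h1 := h.norm_conjApply_sub_le' (r := -r) (by rwa [abs_neg]) v
  have h2 := norm_conjApply h.selfAdjoint_right A v (-r)
  rw [neg_neg] at h2
  rw [← h2, norm_propagator_apply h.selfAdjoint_right]
  have h3 := norm_sub_norm_le (conjApply B A v (-r)) (A v)
  rw [abs_neg] at h1
  have h4 := h.norm_sqrt_le v
  have h5 : 2 * κ ^ 3 * (‖D v‖ + ‖v‖) * |r| ≤ 2 * κ ^ 3 * (2 * (‖A v‖ + ‖v‖)) * κ := by
    gcongr
    linarith [norm_nonneg (A v)]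
  have h6 : 1 ≤ κ ^ 4 := one_le_pow₀ h0
  nlinarith [mul_le_mul_of_nonneg_right h6 (add_nonneg (norm_nonneg (A v)) (norm_nonneg v))]

theorem norm_left_add_propagator_left (h : CommutatorBounds A B D κ) (r : ℝ) (v : E) :
    ‖A (propagator A r v)‖ + ‖propagator A r v‖ = ‖A v‖ + ‖v‖ := by
  rw [propagator_apply_self, norm_propagator_apply h.selfAdjoint_left,
    norm_propagator_apply h.selfAdjoint_left]

end CommutatorBounds

theorem isSelfAdjoint_hamiltonian (hA : IsSelfAdjoint A) (hB : IsSelfAdjoint B) (a b : ℝ) :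
    IsSelfAdjoint ((a : ℂ) • A + (b : ℂ) • B) :=
  (IsSelfAdjoint.smul (Complex.conj_ofReal a) hA).add (IsSelfAdjoint.smul (Complex.conj_ofReal b) hB)

/-- If `w` satisfies the evolution equation of `ψ` up to a residual of size `r`, and both start at
the same point, then they differ at most by `r` times the elapsed time. -/
theorem norm_sub_le_of_residual {f₁ f₂ : ℝ → ℝ} {a b r : ℝ} {ψ w w' : ℝ → E} (hab : a ≤ b)
    (hA : IsSelfAdjoint A) (hB : IsSelfAdjoint B)
    (hψ : ∀ x ∈ Set.Icc a b, HasDerivWithinAt ψ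
      (-Complex.I • ((f₁ x : ℂ) • A + (f₂ x : ℂ) • B) (ψ x)) (Set.Icc a b) x)
    (hw : ∀ x ∈ Set.Icc a b, HasDerivWithinAt w (w' x) (Set.Icc a b) x) (h0 : w a = ψ a)
    (hr : ∀ x ∈ Set.Icc a b,
      ‖w' x - -Complex.I • ((f₁ x : ℂ) • A + (f₂ x : ℂ) • B) (w x)‖ ≤ r) :
    ‖w b - ψ b‖ ≤ r * (b - a) := by
  have := norm_le_of_hasDerivWithinAt_selfAdjoint (e := fun x => w x - ψ x)
    (H := fun x => (f₁ x : ℂ) • A + (f₂ x : ℂ) • B)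
    (g := fun x => w' x - -Complex.I • ((f₁ x : ℂ) • A + (f₂ x : ℂ) • B) (w x)) hab
    (fun x _ => isSelfAdjoint_hamiltonian hA hB _ _)
    (fun x hx => ((hw x hx).sub (hψ x hx)).congr_deriv (by
      rw [map_sub, smul_sub]; abel)) hr b ⟨hab, le_rfl⟩
  simpa [h0] using this

/-- With `t` fixed and the endpoint `x` variable, the path has residual `-i f₁(x) (e^{-iβB} A
e^{iβB} - A) w`, of the size of `β [B, A]`. The kinetic flow preserves `‖A ψ‖` and `‖ψ‖`, so
interpolation after that flow gives the square root in terms of `ψ t`. -/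
theorem norm_generalizedStep_one_sub_le (h : CommutatorBounds A B D κ) {T : ℝ} {f₁ f₂ : ℝ → ℝ}
    (hf₁ : ControlBounds f₁ T κ) (hf₂ : ControlBounds f₂ T κ) {t τ : ℝ} (hτ : 0 ≤ τ) (hτ1 : τ ≤ 1)
    {ψ : ℝ → E} (hψ : ∀ x ∈ Set.Icc t (t + τ), HasDerivWithinAt ψ
      (-Complex.I • ((f₁ x : ℂ) • A + (f₂ x : ℂ) • B) (ψ x)) (Set.Icc t (t + τ)) x) :
    ‖propagator B (∫ s in t..(t + τ), f₂ s) (propagator A (∫ s in t..(t + τ), f₁ s) (ψ t))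
        - ψ (t + τ)‖ ≤ 4 * κ ^ 7 * τ ^ 2 * (√(‖A (ψ t)‖ * ‖ψ t‖) + ‖ψ t‖) := by
  have hκ := h.one_le
  have hw : ∀ x, HasDerivAt (fun x => propagator B (∫ s in t..x, f₂ s)
      (propagator A (∫ s in t..x, f₁ s) (ψ t))) _ x := fun x =>
    hasDerivAt_propagator_comp_apply B (hf₂.hasDerivAt_integral t x)
      (hasDerivAt_propagator_comp_apply A (hf₁.hasDerivAt_integral t x) (hasDerivAt_const x (ψ t)))
  refine (norm_sub_le_of_residual (by linarith) h.selfAdjoint_left h.selfAdjoint_right hψ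
    (fun x _ => (hw x).hasDerivWithinAt) (by simp [propagator_zero])
    (r := 4 * κ ^ 7 * τ * (√(‖A (ψ t)‖ * ‖ψ t‖) + ‖ψ t‖)) ?_).trans_eq (by ring)
  intro x hx
  set β := ∫ s in t..x, f₂ s
  set u := propagator A (∫ s in t..x, f₁ s) (ψ t) with hu
  have hβ : |β| ≤ κ * τ := (hf₂.abs_integral_le hx.1).trans
    (mul_le_mul_of_nonneg_left (by linarith [hx.2]) hf₂.nonneg)
  have hβ' : |β| ≤ κ := hβ.trans (by nlinarith)
  have hdu : ‖D u‖ ≤ √(‖A (ψ t)‖ * ‖ψ t‖) := by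
    apply Real.le_sqrt_of_sq_le
    refine (h.interpolation u).trans_eq ?_
    rw [hu, propagator_apply_self, norm_propagator_apply h.selfAdjoint_left,
      norm_propagator_apply h.selfAdjoint_left]
  have hnu : ‖u‖ = ‖ψ t‖ := norm_propagator_apply h.selfAdjoint_left _ _
  have e1 : propagator B β (A u) = conjApply B A (propagator B β u) β := by
    rw [conjApply, propagator_neg_apply_self]
  have e2 : (-Complex.I • (f₂ x : ℂ) • B (propagator B β u) +
      propagator B β (-Complex.I • (f₁ x : ℂ) • A u +
        propagator A (∫ s in t..x, f₁ s) 0) -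
      -Complex.I • ((f₁ x : ℂ) • A + (f₂ x : ℂ) • B) (propagator B β u)) =
      (-Complex.I * (f₁ x : ℂ)) • (conjApply B A (propagator B β u) β - A (propagator B β u)) := by
    rw [← e1]
    simp only [map_zero, add_zero, map_smul, add_apply,
      smul_apply]
    module
  rw [e2, norm_smul, norm_mul, norm_neg, Complex.norm_I, one_mul, Complex.norm_real]
  calc ‖f₁ x‖ * ‖conjApply B A (propagator B β u) β - A (propagator B β u)‖
      ≤ κ * (2 * κ ^ 3 * (2 * κ ^ 2 * (√(‖A (ψ t)‖ * ‖ψ t‖) + ‖ψ t‖)) * (κ * τ)) := by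
        have h1 := h.norm_conjApply_sub_le' hβ' (propagator B β u)
        have h2 := h.norm_sqrt_add_propagator_le hβ' u
        refine mul_le_mul (hf₁.abs_le x) (h1.trans ?_) (norm_nonneg _) hf₁.nonneg
        gcongr
        refine h2.trans ?_
        rw [hnu]
        gcongr
    _ = _ := by ring

theorem norm_standardStep_one_sub_le (h : CommutatorBounds A B D κ) {T : ℝ} {f₁ f₂ : ℝ → ℝ}
    (hf₁ : ControlBounds f₁ T κ) (hf₂ : ControlBounds f₂ T κ) {t τ : ℝ} (hτ : 0 ≤ τ) (hτ1 : τ ≤ 1)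
    {ψ : ℝ → E} (hψ : ∀ x ∈ Set.Icc t (t + τ), HasDerivWithinAt ψ
      (-Complex.I • ((f₁ x : ℂ) • A + (f₂ x : ℂ) • B) (ψ x)) (Set.Icc t (t + τ)) x) :
    ‖propagator B (τ * f₂ (t + τ)) (propagator A (τ * f₁ (t + τ)) (ψ t)) - ψ (t + τ)‖
      ≤ 10 * κ ^ 7 * τ ^ 2 * (‖A (ψ t)‖ + ‖ψ t‖) := by
  have hκ := h.one_le
  have h1 := norm_generalizedStep_one_sub_le h hf₁ hf₂ hτ hτ1 hψ
  set N := ‖A (ψ t)‖ + ‖ψ t‖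
  have hN : ‖ψ t‖ ≤ N := le_add_of_nonneg_left (norm_nonneg _)
  have hNA : ‖A (ψ t)‖ ≤ N := le_add_of_nonneg_right (norm_nonneg _)
  have hN0 : 0 ≤ N := (norm_nonneg _).trans hN
  have hsq : √(‖A (ψ t)‖ * ‖ψ t‖) ≤ N :=
    Real.sqrt_le_iff.2 ⟨hN0, by rw [pow_two]; gcongr⟩
  have hc : t + τ ∈ Set.Icc t (t + τ) := ⟨by linarith, le_rfl⟩
  have q1 := hf₁.abs_integral_sub_le hc
  have q2 := hf₂.abs_integral_sub_le hc
  -- Here `q1` and `q2` are the right-endpoint quadrature errors, of order `τ²` like the generalized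
  -- local error.
  rw [add_sub_cancel_left, abs_sub_comm] at q1 q2
  set α := ∫ s in t..(t + τ), f₁ s
  set β := ∫ s in t..(t + τ), f₂ s
  have d2 := norm_propagator_sub_le h.selfAdjoint_right (τ * f₂ (t + τ)) β
    (propagator A (τ * f₁ (t + τ)) (ψ t))
  have d1 := norm_propagator_sub_le h.selfAdjoint_left (τ * f₁ (t + τ)) α (ψ t)
  have d2' : ‖B (propagator A (τ * f₁ (t + τ)) (ψ t))‖ ≤ κ * N := by
    refine (h.norm_right_le _).trans ?_
    rw [norm_propagator_apply h.selfAdjoint_left]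
    gcongr
  have d2f := d2.trans (mul_le_mul q2 d2' (norm_nonneg _) (by positivity))
  have d1f := d1.trans (mul_le_mul q1 hNA (norm_nonneg _) (by positivity))
  rw [← norm_propagator_apply h.selfAdjoint_right β, map_sub] at d1f
  have tri := norm_sub_le_norm_sub_add_norm_sub
    (propagator B (τ * f₂ (t + τ)) (propagator A (τ * f₁ (t + τ)) (ψ t)))
    (propagator B β (propagator A (τ * f₁ (t + τ)) (ψ t))) (propagator B β (propagator A α (ψ t)))
  have tri2 := norm_sub_le_norm_sub_add_norm_sub
    (propagator B (τ * f₂ (t + τ)) (propagator A (τ * f₁ (t + τ)) (ψ t)))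
    (propagator B β (propagator A α (ψ t))) (ψ (t + τ))
  have p1 : κ ≤ κ ^ 7 := le_self_pow₀ hκ (by norm_num)
  have p2 : κ ^ 2 ≤ κ ^ 7 := pow_le_pow_right₀ hκ (by norm_num)
  calc _ ≤ κ * τ ^ 2 * (κ * N) + κ * τ ^ 2 * N + 4 * κ ^ 7 * τ ^ 2 * (N + N) := by
        have : 4 * κ ^ 7 * τ ^ 2 * (√(‖A (ψ t)‖ * ‖ψ t‖) + ‖ψ t‖) ≤
            4 * κ ^ 7 * τ ^ 2 * (N + N) := by gcongr
        linarith
    _ = (κ ^ 2 + κ + 8 * κ ^ 7) * (τ ^ 2 * N) := by ring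
    _ ≤ (κ ^ 7 + κ ^ 7 + 8 * κ ^ 7) * (τ ^ 2 * N) := by gcongr
    _ = _ := by ring

end LocalErrors

/-! ### Local errors of the symmetric splittings. -/

section SecondOrder

variable {E : Type*} [NormedAddCommGroup E] [InnerProductSpace ℂ E] [CompleteSpace E]
variable {A B D : E →L[ℂ] E} {κ : ℝ}

/-- The residual of a Strang path `w = e^{-iαA} u`, `u = e^{-iβB} v`, where `a`, `b`, `c` are the
derivatives of the exponents. -/
theorem norm_strang_residual_le (h : CommutatorBounds A B D κ) {a b c α β τ : ℝ} (hτ1 : τ ≤ 1)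
    (hτ : 0 ≤ τ) (hb : |b| ≤ κ) (hc : |c| ≤ κ) (hα : |α| ≤ κ * τ) (hβ : |β| ≤ κ * τ)
    (habc : |b * α - c * β| ≤ κ ^ 2 * τ ^ 2) (v : E) :
    ‖(-Complex.I • (a : ℂ) • A (propagator A α (propagator B β v)) +
      propagator A α (-Complex.I • (b : ℂ) • B (propagator B β v) +
        propagator B β (-Complex.I • (c : ℂ) • A v))) -
      -Complex.I • (((a + c : ℝ) : ℂ) • A + (b : ℂ) • B) (propagator A α (propagator B β v))‖
      ≤ 25 * κ ^ 8 * τ ^ 2 * (‖A v‖ + ‖v‖) := by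
  have hκ := h.one_le
  have hκ0 : 0 ≤ κ := zero_le_one.trans hκ
  have hβ' : |β| ≤ κ := hβ.trans (by nlinarith)
  set N := ‖A v‖ + ‖v‖ with hN
  have hN0 : 0 ≤ N := by positivity
  set u := propagator B β v with hu
  set w := propagator A α u with hw
  have hwN : ‖A w‖ + ‖w‖ ≤ 5 * κ ^ 4 * N := by
    rw [hw, h.norm_left_add_propagator_left]
    exact h.norm_left_add_propagator_le hβ' v
  have hu0 : ‖u‖ ≤ N := by
    rw [hu, norm_propagator_apply h.selfAdjoint_right]
    exact le_add_of_nonneg_left (norm_nonneg _)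
  have comm_le : ∀ x : ℝ, ‖(A * (A * B - B * A) - (A * B - B * A) * A) (propagator A x w)‖
      ≤ κ * (5 * κ ^ 4 * N) := fun x => by
    refine (h.comm_left_comm _).trans ?_
    rw [h.norm_left_add_propagator_left]
    gcongr
  set R₁ := conjApply A B w α - B w + Complex.I • (α : ℂ) • (A * B - B * A) w with hR₁
  set R₂ := propagator A α (conjApply B A u β - A u + Complex.I • (β : ℂ) • (B * A - A * B) u)
    with hR₂
  set R₃ := conjApply A (A * B - B * A) w α - (A * B - B * A) w with hR₃
  have b₁ : ‖R₁‖ ≤ κ * (5 * κ ^ 4 * N) * (κ * τ) ^ 2 := by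
    refine (norm_conjApply_sub_add_le h.selfAdjoint_left fun x _ => comm_le x).trans ?_
    rw [← sq_abs]
    gcongr
  have b₂ : ‖R₂‖ ≤ κ * N * (κ * τ) ^ 2 := by
    rw [hR₂, norm_propagator_apply h.selfAdjoint_left]
    refine (norm_conjApply_sub_add_le h.selfAdjoint_right (M := κ * N) fun x _ => ?_).trans ?_
    · refine (h.comm_right_comm _).trans ?_
      rw [norm_propagator_apply h.selfAdjoint_right]
      gcongr
    · rw [← sq_abs]
      gcongr
  have b₃ : ‖R₃‖ ≤ κ * (5 * κ ^ 4 * N) * (κ * τ) := by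
    refine (norm_conjApply_sub_le h.selfAdjoint_left fun x _ => comm_le x).trans ?_
    gcongr
  have b₄ : ‖(A * B - B * A) w‖ ≤ κ * (2 * (5 * κ ^ 4 * N)) := by
    rw [← norm_neg, ← neg_apply, neg_sub]
    refine (h.comm w).trans ?_
    gcongr
    linarith [h.norm_sqrt_le w, norm_nonneg (A w)]
  have e₁ : conjApply A B w α = propagator A α (B u) := by
    rw [conjApply, hw, propagator_neg_apply_self]
  have e₂ : conjApply A (A * B - B * A) w α = propagator A α ((A * B - B * A) u) := by
    rw [conjApply, hw, propagator_neg_apply_self]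
  have e₃ : conjApply B A u β = propagator B β (A v) := by
    rw [conjApply, hu, propagator_neg_apply_self]
  have e₄ : A w = propagator A α (A u) := propagator_apply_self A α u
  -- Both conjugations are expanded to first order. Their linear terms are multiples of `[A, B]`,
  -- one at `w` and one at `u` transported by the flow of `A`; `R₃` is the cost of moving the second
  -- one to `w`. What remains has the coefficient `b α - c β`, which is small by symmetry of the
  -- splitting.
  have key : (-Complex.I • (a : ℂ) • A w + propagator A α (-Complex.I • (b : ℂ) • B u +
        propagator B β (-Complex.I • (c : ℂ) • A v))) -
      -Complex.I • (((a + c : ℝ) : ℂ) • A + (b : ℂ) • B) w =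
      -Complex.I • ((b : ℂ) • R₁ + (c : ℂ) • R₂ + (Complex.I * (c : ℂ) * (β : ℂ)) • R₃
        - (Complex.I * ((b * α - c * β : ℝ) : ℂ)) • (A * B - B * A) w) := by
    have e₅ : (B * A - A * B) u = -(A * B - B * A) u := by
      rw [← neg_apply, neg_sub]
    rw [hR₁, hR₂, hR₃, e₁, e₂, e₃, e₅]
    simp only [map_add, map_sub, map_smul, map_neg, add_apply, smul_apply, e₄]
    push_cast
    module
  rw [key, norm_smul, norm_neg, Complex.norm_I, one_mul]
  calc _ ≤ ‖(b : ℂ) • R₁‖ + ‖(c : ℂ) • R₂‖ + ‖(Complex.I * (c : ℂ) * (β : ℂ)) • R₃‖ +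
        ‖(Complex.I * ((b * α - c * β : ℝ) : ℂ)) • (A * B - B * A) w‖ :=
        (norm_sub_le _ _).trans (add_le_add_left (norm_add₃_le) _)
    _ = |b| * ‖R₁‖ + |c| * ‖R₂‖ + |c| * |β| * ‖R₃‖ + |b * α - c * β| * ‖(A * B - B * A) w‖ := by
        simp only [norm_smul, norm_mul, Complex.norm_I, one_mul, Complex.norm_real, Real.norm_eq_abs]
    _ ≤ κ * (κ * (5 * κ ^ 4 * N) * (κ * τ) ^ 2) + κ * (κ * N * (κ * τ) ^ 2) +
        κ * (κ * τ) * (κ * (5 * κ ^ 4 * N) * (κ * τ)) +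
        κ ^ 2 * τ ^ 2 * (κ * (2 * (5 * κ ^ 4 * N))) := by gcongr
    _ = (10 * κ ^ 8 + κ ^ 4 + 10 * κ ^ 7) * (τ ^ 2 * N) := by ring
    _ ≤ (10 * κ ^ 8 + κ ^ 8 + 10 * κ ^ 8) * (τ ^ 2 * N) := by
        have p1 : κ ^ 4 ≤ κ ^ 8 := pow_le_pow_right₀ hκ (by norm_num)
        have p2 : κ ^ 7 ≤ κ ^ 8 := pow_le_pow_right₀ hκ (by norm_num)
        gcongr
    _ ≤ 25 * κ ^ 8 * (τ ^ 2 * N) := by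
        apply mul_le_mul_of_nonneg_right _ (by positivity)
        linarith [pow_nonneg hκ0 8]
    _ = _ := by ring

/-- The path consists of generalized steps from `t` to `x`, so the midpoint `(t + x) / 2` moves at
half speed. The two kinetic exponents then have derivatives summing exactly to `f₁ x`, as the
residual bound demands. -/
theorem norm_generalizedStep_two_sub_le (h : CommutatorBounds A B D κ) {T : ℝ} {f₁ f₂ : ℝ → ℝ}
    (hf₁ : ControlBounds f₁ T κ) (hf₂ : ControlBounds f₂ T κ) {t τ : ℝ} (hτ : 0 ≤ τ) (hτ1 : τ ≤ 1)
    {ψ : ℝ → E} (hψ : ∀ x ∈ Set.Icc t (t + τ), HasDerivWithinAt ψ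
      (-Complex.I • ((f₁ x : ℂ) • A + (f₂ x : ℂ) • B) (ψ x)) (Set.Icc t (t + τ)) x) :
    ‖propagator A (∫ s in (t + τ / 2)..(t + τ), f₁ s) (propagator B (∫ s in t..(t + τ), f₂ s)
        (propagator A (∫ s in t..(t + τ / 2), f₁ s) (ψ t))) - ψ (t + τ)‖
      ≤ 25 * κ ^ 8 * τ ^ 3 * (‖A (ψ t)‖ + ‖ψ t‖) := by
  have hκ := h.one_le
  have hκ0 : 0 ≤ κ := zero_le_one.trans hκ
  set F := fun x => ∫ s in t..x, f₁ s with hF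
  have hFsub : ∀ x y, ∫ s in x..y, f₁ s = F y - F x := fun x y =>
    (intervalIntegral.integral_interval_sub_left (hf₁.continuous.intervalIntegrable _ _)
      (hf₁.continuous.intervalIntegrable _ _)).symm
  have hmid : ∀ x : ℝ, HasDerivAt (fun x => (t + x) / 2) (1 / 2) x := fun x =>
    ((hasDerivAt_id x).const_add t).div_const 2
  have hγ : ∀ x : ℝ, HasDerivAt (fun x => F ((t + x) / 2)) (f₁ ((t + x) / 2) * (1 / 2)) x :=
    fun x => HasDerivAt.comp (h₂ := F) (h := fun x => (t + x) / 2) x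
      (hf₁.hasDerivAt_integral t ((t + x) / 2)) (hmid x)
  have hα : ∀ x : ℝ, HasDerivAt (fun x => F x - F ((t + x) / 2))
      (f₁ x - f₁ ((t + x) / 2) * (1 / 2)) x := fun x =>
    (hf₁.hasDerivAt_integral t x).sub (hγ x)
  have hw : ∀ x, HasDerivAt (fun x => propagator A (F x - F ((t + x) / 2))
      (propagator B (∫ s in t..x, f₂ s) (propagator A (F ((t + x) / 2)) (ψ t)))) _ x := fun x =>
    hasDerivAt_propagator_comp_apply A (hα x)
      (hasDerivAt_propagator_comp_apply B (hf₂.hasDerivAt_integral t x)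
        (hasDerivAt_propagator_comp_apply A (hγ x) (hasDerivAt_const x (ψ t))))
  have hmid2 : t + τ / 2 = (t + (t + τ)) / 2 := by ring
  rw [hFsub, hFsub, hmid2]
  have hFt : F t = 0 := by simp [hF]
  rw [hFt, sub_zero]
  refine (norm_sub_le_of_residual (by linarith) h.selfAdjoint_left h.selfAdjoint_right hψ
    (fun x _ => (hw x).hasDerivWithinAt) (by simp [hF, propagator_zero])
    (r := 25 * κ ^ 8 * τ ^ 2 * (‖A (ψ t)‖ + ‖ψ t‖)) ?_).trans_eq (by ring)
  intro x hx
  have hxt : 0 ≤ x - t := by linarith [hx.1]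
  have hxτ : x - t ≤ τ := by linarith [hx.2]
  have hc : (t + x) / 2 ∈ Set.Icc ((t + x) / 2) x := ⟨le_rfl, by linarith⟩
  have i1 := hf₁.abs_integral_le hc.2
  have i2 := hf₂.abs_integral_le hx.1
  have q1 := hf₁.abs_integral_sub_le hc
  have q2 := hf₂.abs_integral_sub_le (a := t) (b := x) (c := x) ⟨hx.1, le_rfl⟩
  rw [hFsub] at i1 q1
  have := norm_strang_residual_le h (a := f₁ x - f₁ ((t + x) / 2) * (1 / 2)) (b := f₂ x)
    (c := f₁ ((t + x) / 2) * (1 / 2)) (α := F x - F ((t + x) / 2)) (β := ∫ s in t..x, f₂ s)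
    hτ1 hτ (hf₂.abs_le x)
    (by rw [abs_mul, abs_of_pos (by norm_num : (0 : ℝ) < 1 / 2)]
        linarith [hf₁.abs_le ((t + x) / 2), abs_nonneg (f₁ ((t + x) / 2))])
    (i1.trans (by gcongr; linarith)) (i2.trans (by gcongr))
    (by
      set g := F x - F ((t + x) / 2)
      set β := ∫ s in t..x, f₂ s
      set k := f₁ ((t + x) / 2)
      -- To leading order both products equal `f₁ f₂ (x - t) / 2`. The differences are
      -- rectangle-rule errors, so Lipschitz controls suffice here.
      have e : f₂ x * g - k * (1 / 2) * β = f₂ x * (g - (x - (t + x) / 2) * k)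
          - k * (1 / 2) * (β - (x - t) * f₂ x) := by ring
      have k1 : |k| ≤ κ := hf₁.abs_le _
      have k2 : |f₂ x| ≤ κ := hf₂.abs_le _
      rw [e]
      calc _ ≤ |f₂ x| * |g - (x - (t + x) / 2) * k| + |k| * (1 / 2) * |β - (x - t) * f₂ x| := by
            refine (abs_sub _ _).trans_eq ?_
            rw [abs_mul, abs_mul, abs_mul, abs_of_pos (by norm_num : (0 : ℝ) < 1 / 2)]
        _ ≤ κ * (κ * (x - (t + x) / 2) ^ 2) + κ * (1 / 2) * (κ * (x - t) ^ 2) := by gcongr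
        _ = κ ^ 2 * (3 / 4 * (x - t) ^ 2) := by ring
        _ ≤ κ ^ 2 * τ ^ 2 := by
            gcongr
            nlinarith)
    (propagator A (F ((t + x) / 2)) (ψ t))
  rw [h.norm_left_add_propagator_left] at this
  simpa only [map_zero, add_zero, sub_add_cancel] using this

theorem norm_comm_propagator_le (h : CommutatorBounds A B D κ) {r : ℝ} (hr : |r| ≤ κ) (v : E) :
    ‖(A * propagator B r - propagator B r * A) v‖ ≤ 8 * κ ^ 5 * (‖A v‖ + ‖v‖) * |r| := by
  have hκ0 : 0 ≤ κ := zero_le_one.trans h.one_le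
  have h1 := h.norm_conjApply_sub_le' hr (propagator B r v)
  have h2 := h.norm_sqrt_add_propagator_le hr v
  rw [conjApply, propagator_neg_apply_self, norm_sub_rev] at h1
  refine h1.trans ?_
  calc _ ≤ 2 * κ ^ 3 * (2 * κ ^ 2 * (2 * (‖A v‖ + ‖v‖))) * |r| := by
        gcongr
        refine h2.trans ?_
        gcongr
        linarith [h.norm_sqrt_le v, norm_nonneg (A v)]
    _ = _ := by ring

/-- The sum of the two kinetic exponents agrees with `2 a` up to `O(τ³)` by the midpoint rule, but
each half agrees with `a` only up to `O(τ²)`. Shifting exponent from one half to the other costs a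
commutator with `e^{-ibB}`, itself `O(τ)`, so the total is again `O(τ³)`. -/
theorem norm_standardStep_two_sub_le (h : CommutatorBounds A B D κ) {T : ℝ} {f₁ f₂ : ℝ → ℝ}
    (hf₁ : ControlBounds f₁ T κ) (hf₂ : ControlBounds f₂ T κ) {t τ : ℝ} (hτ : 0 ≤ τ) (hτ1 : τ ≤ 1)
    (ht : 0 ≤ t) (htT : t + τ ≤ T)
    {ψ : ℝ → E} (hψ : ∀ x ∈ Set.Icc t (t + τ), HasDerivWithinAt ψ
      (-Complex.I • ((f₁ x : ℂ) • A + (f₂ x : ℂ) • B) (ψ x)) (Set.Icc t (t + τ)) x) :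
    ‖propagator A (τ / 2 * f₁ (t + τ / 2)) (propagator B (τ * f₂ (t + τ / 2))
        (propagator A (τ / 2 * f₁ (t + τ / 2)) (ψ t))) - ψ (t + τ)‖
      ≤ 35 * κ ^ 8 * τ ^ 3 * (‖A (ψ t)‖ + ‖ψ t‖) := by
  have hκ := h.one_le
  have hκ0 : 0 ≤ κ := zero_le_one.trans hκ
  have hgen := norm_generalizedStep_two_sub_le h hf₁ hf₂ hτ hτ1 hψ
  set N := ‖A (ψ t)‖ + ‖ψ t‖ with hN
  have hN0 : 0 ≤ N := by positivity
  have hψN : ‖ψ t‖ ≤ N := le_add_of_nonneg_left (norm_nonneg _)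
  have hAN : ‖A (ψ t)‖ ≤ N := le_add_of_nonneg_right (norm_nonneg _)
  have hmid : (t + (t + τ)) / 2 = t + τ / 2 := by ring
  have m1 := hf₁.abs_integral_sub_midpoint_le (a := t) (b := t + τ) (by linarith) ht htT
  have m2 := hf₂.abs_integral_sub_midpoint_le (a := t) (b := t + τ) (by linarith) ht htT
  have m3 := hf₁.abs_integral_sub_le (a := t + τ / 2) (b := t + τ) (c := t + τ / 2)
    ⟨le_rfl, by linarith⟩
  rw [← intervalIntegral.integral_add_adjacent_intervals (b := t + τ / 2)
    (hf₁.continuous.intervalIntegrable _ _) (hf₁.continuous.intervalIntegrable _ _)] at m1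
  rw [hmid, add_sub_cancel_left] at m1 m2
  have e3 : t + τ - (t + τ / 2) = τ / 2 := by ring
  rw [e3] at m3
  set α := ∫ s in (t + τ / 2)..(t + τ), f₁ s
  set β := ∫ s in t..(t + τ), f₂ s
  set γ := ∫ s in t..(t + τ / 2), f₁ s
  set a := τ / 2 * f₁ (t + τ / 2) with ha
  set b := τ * f₂ (t + τ / 2) with hb
  have ea : τ * f₁ (t + τ / 2) = 2 * a := by rw [ha]; ring
  rw [ea] at m1
  have hbκ : |b| ≤ κ * τ := by
    rw [hb, abs_mul, abs_of_nonneg hτ, mul_comm]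
    gcongr
    exact hf₂.abs_le _
  have hbκ' : |b| ≤ κ := hbκ.trans (by nlinarith)
  set v := propagator A a (ψ t) with hv
  have hvN : ‖A v‖ + ‖v‖ = N := h.norm_left_add_propagator_left a (ψ t)
  set X := propagator B b
  -- replace `β` by `b`
  have s1 : ‖propagator A α (X (propagator A γ (ψ t))) -
      propagator A α (propagator B β (propagator A γ (ψ t)))‖ ≤ κ * τ ^ 3 * (κ * N) := by
    rw [← map_sub, norm_propagator_apply h.selfAdjoint_left]
    refine (norm_propagator_sub_le h.selfAdjoint_right _ _ _).trans ?_
    rw [abs_sub_comm]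
    refine mul_le_mul m2 ((h.norm_right_le _).trans ?_) (norm_nonneg _) (by positivity)
    rw [norm_propagator_apply h.selfAdjoint_left]
    gcongr
  -- replace `γ` by `2 a - α`
  have s2 : ‖propagator A α (X (propagator A (2 * a - α) (ψ t))) -
      propagator A α (X (propagator A γ (ψ t)))‖ ≤ κ * τ ^ 3 * N := by
    rw [← map_sub, norm_propagator_apply h.selfAdjoint_left, ← map_sub,
      norm_propagator_apply h.selfAdjoint_right]
    refine (norm_propagator_sub_le h.selfAdjoint_left _ _ _).trans ?_
    refine mul_le_mul ?_ hAN (norm_nonneg _) (by positivity)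
    rwa [abs_sub_comm, show γ - (2 * a - α) = γ + α - 2 * a by ring]
  -- the antisymmetric part of the perturbation only enters through a commutator
  have s3 : ‖propagator A a (X v) - propagator A α (X (propagator A (2 * a - α) (ψ t)))‖
      ≤ 8 * κ ^ 5 * N * (κ * τ) * (κ * τ ^ 2) := by
    have e1 : propagator A α (X (propagator A (2 * a - α) (ψ t))) =
        propagator A a (conjApply A X v (α - a)) := by
      rw [conjApply, ← propagator_add_apply, hv, ← propagator_add_apply]
      rw [add_sub_cancel, show -(α - a) + a = 2 * a - α by ring]
    rw [e1, ← map_sub, norm_propagator_apply h.selfAdjoint_left, norm_sub_rev]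
    refine (norm_conjApply_sub_le (M := 8 * κ ^ 5 * N * (κ * τ)) h.selfAdjoint_left
      fun x _ => ?_).trans ?_
    · refine (norm_comm_propagator_le h hbκ' _).trans ?_
      rw [h.norm_left_add_propagator_left, hvN]
      gcongr
    · gcongr
      refine m3.trans ?_
      gcongr
      linarith
  have t1 := norm_sub_le_norm_sub_add_norm_sub (propagator A a (X v))
    (propagator A α (X (propagator A (2 * a - α) (ψ t)))) (ψ (t + τ))
  have t2 := norm_sub_le_norm_sub_add_norm_sub
    (propagator A α (X (propagator A (2 * a - α) (ψ t))))
    (propagator A α (X (propagator A γ (ψ t)))) (ψ (t + τ))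
  have t3 := norm_sub_le_norm_sub_add_norm_sub
    (propagator A α (X (propagator A γ (ψ t))))
    (propagator A α (propagator B β (propagator A γ (ψ t)))) (ψ (t + τ))
  have p1 : κ ≤ κ ^ 8 := le_self_pow₀ hκ (by norm_num)
  have p2 : κ ^ 2 ≤ κ ^ 8 := pow_le_pow_right₀ hκ (by norm_num)
  have p7 : κ ^ 7 ≤ κ ^ 8 := pow_le_pow_right₀ hκ (by norm_num)
  calc _ ≤ κ * τ ^ 3 * (κ * N) + κ * τ ^ 3 * N + 8 * κ ^ 5 * N * (κ * τ) * (κ * τ ^ 2)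
        + 25 * κ ^ 8 * τ ^ 3 * N := by linarith
    _ = (κ ^ 2 + κ + 8 * κ ^ 7 + 25 * κ ^ 8) * (τ ^ 3 * N) := by ring
    _ ≤ (κ ^ 8 + κ ^ 8 + 8 * κ ^ 8 + 25 * κ ^ 8) * (τ ^ 3 * N) := by gcongr
    _ = _ := by ring

end SecondOrder

/-! ### Discrete Leibniz calculus for the shift and the commutator bounds. -/

section ShiftCalculus

/-- Commutator of the second difference `ν² (2 - s - s⁻¹)` with an operator `w` whose difference
quotients with respect to the shift `s` are `w'` and `w''`. -/
theorem secondDifference_comm {R : Type*} [Ring R] [Algebra ℂ R] {ν : ℂ}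
    {s t w w' w'' : R} (hst : s * t = 1) (hts : t * s = 1)
    (h : ν • (s * w - w * s) = w' * s) (h' : ν • (s * w' - w' * s) = w'' * s) :
    (ν ^ 2 • (2 - s - t)) * w - w * (ν ^ 2 • (2 - s - t)) =
      -(w' * ((1 + t) * (ν • (s - 1))) + t * w'') := by
  -- Multiplying the rule for `s` by `t` on both sides gives the rule for the inverse shift.
  have a1 : ν • (w * t - t * w) = t * w' := by
    have := congrArg (fun z => t * z * t) h
    simp only [mul_smul_comm, smul_mul_assoc, mul_sub, sub_mul, mul_assoc, hst, mul_one] at this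
    simpa only [← mul_assoc, hts, one_mul] using this
  have a2 : ν • (w' * t - t * w') = t * w'' := by
    have := congrArg (fun z => t * z * t) h'
    simp only [mul_smul_comm, smul_mul_assoc, mul_sub, sub_mul, mul_assoc, hst, mul_one] at this
    simpa only [← mul_assoc, hts, one_mul] using this
  have e1 : (ν ^ 2 • (2 - s - t)) * w - w * (ν ^ 2 • (2 - s - t)) =
      -(ν • (ν • (s * w - w * s))) + ν • (ν • (w * t - t * w)) := by
    have : (2 : R) * w = w * 2 := by rw [two_mul, mul_two]
    simp only [mul_smul_comm, smul_mul_assoc, mul_sub, sub_mul, this]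
    module
  have e2 : (1 + t) * (ν • (s - 1)) = ν • (s - t) := by
    simp only [mul_smul_comm, add_mul, mul_sub, one_mul, mul_one, hts]
    congr 1
    abel
  rw [e1, a1, h, e2, ← a2]
  simp only [mul_smul_comm, mul_sub]
  module

/-- Discrete form of `[V, [V, -∂²]] = -2 V'²`: the second commutator removes the remaining
difference and leaves an operator of order zero. -/
theorem potential_comm_comm {R : Type*} [Ring R] [Algebra ℂ R] {ν : ℂ}
    {s t w w' : R} (hst : s * t = 1) (hts : t * s = 1) (hw : w * w' = w' * w)
    (h : ν • (s * w - w * s) = w' * s) :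
    w * (w * (ν ^ 2 • (2 - s - t)) - (ν ^ 2 • (2 - s - t)) * w) -
      (w * (ν ^ 2 • (2 - s - t)) - (ν ^ 2 • (2 - s - t)) * w) * w =
      -(w' * w' * s + t * (w' * w')) := by
  have a1 : ν • (w * t - t * w) = t * w' := by
    have := congrArg (fun z => t * z * t) h
    simp only [mul_smul_comm, smul_mul_assoc, mul_sub, sub_mul, mul_assoc, hst, mul_one] at this
    simpa only [← mul_assoc, hts, one_mul] using this
  have e1 : w * (ν ^ 2 • (2 - s - t)) - (ν ^ 2 • (2 - s - t)) * w =
      ν • (w' * s - t * w') := by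
    have : (2 : R) * w = w * 2 := by rw [two_mul, mul_two]
    rw [← h, ← a1]
    simp only [mul_smul_comm, smul_mul_assoc, mul_sub, sub_mul, this]
    module
  have e2 : ν • (w * (w' * s) - w' * s * w) = -(w' * w' * s) := by
    rw [← mul_assoc, hw, mul_assoc, mul_assoc, ← mul_sub, ← neg_sub, mul_neg, smul_neg,
      ← mul_smul_comm, h, mul_assoc]
  have e3 : ν • (w * (t * w') - t * w' * w) = t * (w' * w') := by
    rw [mul_assoc, ← hw, ← mul_assoc, ← mul_assoc, ← sub_mul, ← smul_mul_assoc, a1, mul_assoc]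
  rw [e1, neg_add, ← e2, ← e3]
  simp only [mul_smul_comm, smul_mul_assoc, mul_sub, sub_mul]
  module

variable {E : Type*} [NormedAddCommGroup E] [InnerProductSpace ℂ E] [CompleteSpace E]

/-- `W j` stands for the `j`-th difference quotient of the potential. Four of them are needed,
because `[A, [A, W 0]]` contains `[A, W 2]`, which contains `W 4`. -/
theorem commutatorBounds_of_shift {S : E →L[ℂ] E} {W : ℕ → E →L[ℂ] E} {ν K κ : ℝ}
    (hS : S * star S = 1) (hS' : star S * S = 1) (hW₀ : IsSelfAdjoint (W 0))
    (hcomm : W 0 * W 1 = W 1 * W 0)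
    (hW : ∀ j < 4, (ν : ℂ) • (S * W j - W j * S) = W (j + 1) * S)
    (hK : ∀ j ≤ 4, ∀ v, ‖W j v‖ ≤ K * ‖v‖) (hK0 : 0 ≤ K) (h1 : 1 ≤ κ) (h2 : 8 * K ≤ κ)
    (h3 : 2 * K ^ 2 ≤ κ) :
    CommutatorBounds ((ν : ℂ) ^ 2 • (2 - S - star S)) (W 0) ((ν : ℂ) • (S - 1)) κ := by
  set A : E →L[ℂ] E := (ν : ℂ) ^ 2 • (2 - S - star S) with hA
  set D : E →L[ℂ] E := (ν : ℂ) • (S - 1) with hD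
  have nS : ∀ v, ‖S v‖ = ‖v‖ := ContinuousLinearMap.norm_map_of_mem_unitary
    (Unitary.mem_iff.2 ⟨hS', hS⟩)
  have nT : ∀ v, ‖star S v‖ = ‖v‖ := ContinuousLinearMap.norm_map_of_mem_unitary
    (Unitary.star_mem (Unitary.mem_iff.2 ⟨hS', hS⟩))
  have starD : star D * D = A := by
    rw [hD, hA, star_smul, star_sub, star_one, Complex.star_def, Complex.conj_ofReal]
    simp only [smul_mul_assoc, mul_smul_comm, sub_mul, mul_sub, hS', one_mul, mul_one]
    rw [← one_add_one_eq_two (R := E →L[ℂ] E)]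
    module
  -- The forward second difference is a shift of the central one; as `S` is unitary, `‖D² v‖ = ‖A
  -- v‖`.
  have hTDD : star S * (D * D) = -A := by
    rw [hD, hA]
    simp only [smul_mul_assoc, mul_smul_comm, sub_mul, mul_sub, one_mul, mul_one]
    rw [← mul_assoc, hS', ← one_add_one_eq_two (R := E →L[ℂ] E), one_mul]
    module
  have hDD : ∀ v, ‖D (D v)‖ = ‖A v‖ := fun v => by
    rw [← nT, ← norm_neg (A v)]
    exact congrArg norm (DFunLike.congr_fun hTDD v)
  have hinter : ∀ v, ‖D v‖ ^ 2 ≤ ‖A v‖ * ‖v‖ := fun v => by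
    have e : inner ℂ (D v) (D v) = inner ℂ (A v) v := by
      rw [← starD]
      exact (ContinuousLinearMap.adjoint_inner_left D v (D v)).symm
    calc ‖D v‖ ^ 2 = ‖inner ℂ (D v) (D v)‖ := by rw [inner_self_eq_norm_sq_to_K]; simp
      _ ≤ ‖A v‖ * ‖v‖ := by rw [e]; exact norm_inner_le_norm _ _
  have hD_le : ∀ v, ‖D v‖ ≤ ‖A v‖ + ‖v‖ := fun v => by
    refine (pow_le_pow_iff_left₀ (norm_nonneg _) (by positivity) two_ne_zero).1 ?_
    nlinarith [norm_nonneg (A v), norm_nonneg v, hinter v]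
  have cST : Commute S (star S) := hS.trans hS'.symm
  have cSA : Commute S A :=
    (((Commute.ofNat_right S 2).sub_right (Commute.refl S)).sub_right cST).smul_right _
  have cTA : Commute (star S) A :=
    (((Commute.ofNat_right (star S) 2).sub_right cST.symm).sub_right (Commute.refl _)).smul_right _
  have cDA : Commute D A := (cSA.sub_left (Commute.one_left A)).smul_left _
  have cTD : Commute (star S) D := (cST.symm.sub_right (Commute.one_right _)).smul_right _
  -- `Z` is `ν (S - S*)`, the discrete `2 ∂`. Being a polynomial in `S` and `S*`, it commutes with
  -- `A` and `D`.
  set Z := (1 + star S) * D with hZ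
  have cZA : Commute Z A := ((Commute.one_left A).add_left cTA).mul_left cDA
  have cDZ : Commute D Z := ((Commute.one_right D).add_right cTD.symm).mul_right (Commute.refl D)
  have nZ : ∀ v, ‖Z v‖ ≤ 2 * ‖D v‖ := fun v => by
    have : Z v = D v + star S (D v) := rfl
    rw [this]
    refine (norm_add_le _ _).trans_eq ?_
    rw [nT, two_mul]
  have nDZ : ∀ v, ‖D (Z v)‖ ≤ 2 * ‖A v‖ := fun v => by
    have : D (Z v) = Z (D v) := DFunLike.congr_fun cDZ.eq v
    rw [this, ← hDD]
    exact nZ _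
  have comm : ∀ j < 3, A * W j - W j * A = -(W (j + 1) * Z + star S * W (j + 2)) := fun j hj =>
    secondDifference_comm hS hS' (hW j (by omega)) (hW (j + 1) (by omega))
  have comm_le : ∀ j < 3, ∀ v, ‖(A * W j - W j * A) v‖ ≤ 2 * K * ‖D v‖ + K * ‖v‖ :=
    fun j hj v => by
    rw [comm j hj, neg_apply, norm_neg]
    refine (norm_add_le _ _).trans ?_
    refine add_le_add ((hK (j + 1) (by omega) (Z v)).trans ?_)
      ((nT _).trans_le (hK (j + 2) (by omega) v))
    calc K * ‖Z v‖ ≤ K * (2 * ‖D v‖) := by gcongr; exact nZ v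
      _ = _ := by ring
  have hA_sa : IsSelfAdjoint A := by
    rw [← starD]
    exact IsSelfAdjoint.star_mul_self D
  refine ⟨hA_sa, hW₀, h1, hinter, fun v => (hK 0 (by omega) v).trans ?_, fun v => ?_, fun v => ?_,
    fun v => ?_, fun v => ?_⟩
  · gcongr
    linarith
  · have e : W 0 * D - D * W 0 = -(W 1 * S) := by
      rw [← hW 0 (by omega), hD]
      simp only [smul_mul_assoc, mul_smul_comm, sub_mul, mul_sub, one_mul, mul_one]
      module
    rw [e, neg_apply, norm_neg]
    refine (hK 1 (by omega) (S v)).trans ?_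
    rw [nS]
    gcongr
    linarith
  · rw [← norm_neg, ← neg_apply, neg_sub]
    refine (comm_le 0 (by omega) v).trans ?_
    nlinarith [mul_nonneg hK0 (norm_nonneg (D v)), mul_nonneg hK0 (norm_nonneg v),
      mul_le_mul_of_nonneg_right h2 (norm_nonneg (D v)),
      mul_le_mul_of_nonneg_right h2 (norm_nonneg v)]
  · have e : A * (A * W 0 - W 0 * A) - (A * W 0 - W 0 * A) * A =
        -((A * W 1 - W 1 * A) * Z + star S * (A * W 2 - W 2 * A)) := by
      rw [comm 0 (by omega)]
      have q1 : Z * A = A * Z := cZA.eq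
      have q2 : A * star S = star S * A := cTA.eq.symm
      have q3 : W 1 * Z * A = W 1 * A * Z := by rw [mul_assoc, q1, ← mul_assoc]
      have q4 : A * (star S * W 2) = star S * (A * W 2) := by rw [← mul_assoc, q2, mul_assoc]
      simp only [mul_neg, neg_mul, mul_add, add_mul, sub_mul, mul_sub, q3, zero_add, q4,
        ← mul_assoc A (W 1) Z, ← mul_assoc (star S) (W 2) A]
      abel
    rw [e, neg_apply, norm_neg]
    refine (norm_add_le _ _).trans ?_
    have i1 := comm_le 1 (by omega) (Z v)
    have i2 := (nT ((A * W 2 - W 2 * A) v)).trans_le (comm_le 2 (by omega) v)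
    have i3 : 2 * K * ‖D (Z v)‖ ≤ 2 * K * (2 * ‖A v‖) := by gcongr; exact nDZ v
    have i4 : K * ‖Z v‖ ≤ K * (2 * (‖A v‖ + ‖v‖)) := by
      gcongr
      exact (nZ v).trans (by linarith [hD_le v])
    have i5 : 2 * K * ‖D v‖ ≤ 2 * K * (‖A v‖ + ‖v‖) := by gcongr; exact hD_le v
    calc _ ≤ _ := add_le_add i1 i2
      _ ≤ 8 * K * (‖A v‖ + ‖v‖) := by nlinarith [mul_nonneg hK0 (norm_nonneg v)]
      _ ≤ _ := by gcongr
  · rw [hA, potential_comm_comm hS hS' hcomm (hW 0 (by omega)), neg_apply, norm_neg]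
    refine (norm_add_le _ _).trans ?_
    have i1 : ‖W 1 (W 1 (S v))‖ ≤ K * (K * ‖v‖) := by
      refine (hK 1 (by omega) _).trans ?_
      gcongr
      exact (hK 1 (by omega) _).trans_eq (by rw [nS])
    have i2 : ‖star S (W 1 (W 1 v))‖ ≤ K * (K * ‖v‖) := by
      rw [nT]
      refine (hK 1 (by omega) _).trans ?_
      gcongr
      exact hK 1 (by omega) _
    calc _ ≤ _ := add_le_add i1 i2
      _ = 2 * K ^ 2 * ‖v‖ := by ring
      _ ≤ _ := by gcongr

end ShiftCalculus

/-! ### The sampled potential and the finite-difference matrices. -/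

section Potential

/-- The forward difference quotient with step `1 / n`. -/
noncomputable def diffQuotient (n : ℕ) (u : ℝ → ℝ) (x : ℝ) : ℝ :=
  n * (u (x + 1 / n) - u x)

/-- `u` is `1`-periodic and `C^m`, with derivatives up to order `m` bounded by `K`. -/
def BoundedPeriodic (K : ℝ) (m : ℕ) (u : ℝ → ℝ) : Prop :=
  Function.Periodic u 1 ∧ ContDiff ℝ m u ∧ ∀ j ≤ m, ∀ x : ℝ, |iteratedDeriv j u x| ≤ K

/-- Difference quotients commute with derivatives, so the mean value theorem keeps the same `K`,
independent of `n`, at the price of one derivative. -/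
theorem BoundedPeriodic.diffQuotient {K : ℝ} {m n : ℕ} [NeZero n] {u : ℝ → ℝ}
    (hu : BoundedPeriodic K (m + 1) u) : BoundedPeriodic K m (diffQuotient n u) := by
  obtain ⟨hp, hd, hb⟩ := hu
  have hdm : ContDiff ℝ m u := hd.of_le (by exact_mod_cast m.le_succ)
  have hshift : ContDiff ℝ m fun x => u (x + 1 / n) := hdm.comp (contDiff_id.add contDiff_const)
  have hn : (0 : ℝ) < n := Nat.cast_pos.2 (NeZero.pos n)
  refine ⟨fun x => ?_, contDiff_const.mul (hshift.sub hdm), fun j hj x => ?_⟩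
  · rw [TrotterFD.diffQuotient, TrotterFD.diffQuotient, hp x, add_right_comm, hp]
  · have hj' : ContDiffAt ℝ j u x := hdm.contDiffAt.of_le (by exact_mod_cast hj)
    have hj'' : ContDiffAt ℝ j (fun x => u (x + 1 / n)) x :=
      hshift.contDiffAt.of_le (by exact_mod_cast hj)
    have e : iteratedDeriv j (TrotterFD.diffQuotient n u) x =
        n * (iteratedDeriv j u (x + 1 / n) - iteratedDeriv j u x) := by
      unfold TrotterFD.diffQuotient
      rw [iteratedDeriv_const_mul _ (hj''.sub hj'), iteratedDeriv_fun_sub hj'' hj',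
        iteratedDeriv_comp_add_const]
    have hder : ∀ y, HasDerivAt (iteratedDeriv j u) (iteratedDeriv (j + 1) u y) y := fun y => by
      rw [iteratedDeriv_succ]
      exact ((hd.differentiable_iteratedDeriv j (by exact_mod_cast Nat.lt_succ_of_le hj)) y).hasDerivAt
    have mv := Convex.norm_image_sub_le_of_norm_hasDerivWithin_le (s := Set.univ)
      (f := iteratedDeriv j u) (x := x) (y := x + 1 / n) (fun y _ => (hder y).hasDerivWithinAt)
      (fun y _ => hb (j + 1) (by omega) y) convex_univ trivial trivial
    rw [add_sub_cancel_left, Real.norm_eq_abs, Real.norm_eq_abs,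
      abs_of_pos (one_div_pos.2 hn)] at mv
    rw [e, abs_mul, abs_of_pos hn]
    calc (n : ℝ) * |iteratedDeriv j u (x + 1 / n) - iteratedDeriv j u x|
        ≤ n * (K * (1 / n)) := by gcongr
      _ = K := by field_simp

theorem BoundedPeriodic.iterate_diffQuotient {K : ℝ} {m n : ℕ} [NeZero n] {u : ℝ → ℝ} (j : ℕ)
    (hu : BoundedPeriodic K (m + j) u) : BoundedPeriodic K m ((TrotterFD.diffQuotient n)^[j] u) := by
  induction j generalizing u with
  | zero => exact hu
  | succ j ih => exact ih hu.diffQuotient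

theorem sample_add_one {n : ℕ} [NeZero n] {α : Type} {u : ℝ → α} (hu : Function.Periodic u 1)
    (i : Fin n) : sample n u (i + 1) = u ((i : ℕ) / (n : ℝ) + 1 / n) := by
  have hn : (n : ℝ) ≠ 0 := Nat.cast_ne_zero.2 (NeZero.ne n)
  have hv : ((i + 1 : Fin n) : ℕ) = ((i : ℕ) + 1) % n := by
    rw [Fin.val_add, Fin.val_one', Nat.add_mod_mod]
  -- At the last node the index wraps around; the point then differs by an integer, which
  -- periodicity absorbs.
  have hdiv : ((i : ℕ) : ℝ) / n + 1 / n = (((i : ℕ) + 1) % n : ℕ) / (n : ℝ)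
      + (((i : ℕ) + 1) / n : ℕ) := by
    have := congrArg (Nat.cast (R := ℝ)) (Nat.mod_add_div ((i : ℕ) + 1) n)
    push_cast at this
    field_simp
    linarith
  rw [sample, hv, hdiv]
  exact ((hu.nat_mul (((i : ℕ) + 1) / n)) _ |>.symm.trans (by rw [mul_one]))

/-- The cyclic shift `(S v)_k = v_{k + 1}`. -/
def shiftMatrix (n : ℕ) [NeZero n] : Matrix (Fin n) (Fin n) ℂ :=
  Matrix.of fun i j => if j = i + 1 then 1 else 0

theorem norm_fdPotential_le {n : ℕ} {u : ℝ → ℝ} {K : ℝ} (hK : 0 ≤ K) (hu : ∀ x, |u x| ≤ K) :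
    ‖fdPotential n u‖ ≤ K := by
  rw [fdPotential, Matrix.l2_opNorm_diagonal]
  exact (pi_norm_le_iff_of_nonneg hK).2 fun i => by simpa [sample] using hu _

theorem star_fdPotential {n : ℕ} (u : ℝ → ℝ) : star (fdPotential n u) = fdPotential n u := by
  rw [fdPotential, Matrix.star_eq_conjTranspose, Matrix.diagonal_conjTranspose]
  congr 1
  ext i
  simp [sample]

theorem fdPotential_commute {n : ℕ} (u v : ℝ → ℝ) :
    fdPotential n u * fdPotential n v = fdPotential n v * fdPotential n u := by
  simp [fdPotential, Matrix.diagonal_mul_diagonal, mul_comm]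

variable {n : ℕ} [NeZero n]

theorem shiftMatrix_mul_star : shiftMatrix n * star (shiftMatrix n) = 1 := by
  ext i j
  simp [shiftMatrix, Matrix.mul_apply, Matrix.star_apply, Matrix.one_apply, eq_comm]

theorem star_mul_shiftMatrix : star (shiftMatrix n) * shiftMatrix n = 1 :=
  mul_eq_one_comm.1 shiftMatrix_mul_star

theorem fdLaplacian_eq : fdLaplacian n =
    (n : ℂ) ^ 2 • (2 - shiftMatrix n - star (shiftMatrix n)) := by
  ext i j
  simp [fdLaplacian, shiftMatrix, Matrix.star_apply, Matrix.ofNat_apply]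

theorem shiftMatrix_comm_fdPotential {u : ℝ → ℝ} (hu : Function.Periodic u 1) :
    (n : ℂ) • (shiftMatrix n * fdPotential n u - fdPotential n u * shiftMatrix n) =
      fdPotential n (diffQuotient n u) * shiftMatrix n := by
  ext i j
  have hper : Function.Periodic (fun x => (u x : ℂ)) 1 := fun x => by simp only [hu x]
  simp only [fdPotential, shiftMatrix, Matrix.smul_apply, Matrix.sub_apply,
    Matrix.mul_diagonal, Matrix.diagonal_mul, Matrix.of_apply, smul_eq_mul]
  split_ifs with h
  · rw [h, sample_add_one hper]
    simp [sample, diffQuotient]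
  · simp

theorem commutatorBounds_fd {V : ℝ → ℝ} {K κ : ℝ} (hV : BoundedPeriodicC4 K V) (hK : 0 ≤ K)
    (h1 : 1 ≤ κ) (h2 : 8 * K ≤ κ) (h3 : 2 * K ^ 2 ≤ κ) :
    CommutatorBounds (Matrix.toEuclideanCLM (𝕜 := ℂ) (fdLaplacian n))
      (Matrix.toEuclideanCLM (𝕜 := ℂ) (fdPotential n V))
      (Matrix.toEuclideanCLM (𝕜 := ℂ) ((n : ℂ) • (shiftMatrix n - 1))) κ := by
  have hV4 : ∀ j ≤ 4, BoundedPeriodic K (4 - j) ((diffQuotient n)^[j] V) := fun j hj =>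
    BoundedPeriodic.iterate_diffQuotient j (by rw [Nat.sub_add_cancel hj]; exact hV)
  have := commutatorBounds_of_shift (S := Matrix.toEuclideanCLM (𝕜 := ℂ) (shiftMatrix n))
    (W := fun j => Matrix.toEuclideanCLM (𝕜 := ℂ) (fdPotential n ((diffQuotient n)^[j] V)))
    (ν := n) (K := K) (κ := κ)
    (by rw [← map_star, ← map_mul, shiftMatrix_mul_star, map_one])
    (by rw [← map_star, ← map_mul, star_mul_shiftMatrix, map_one])
    (by rw [IsSelfAdjoint, ← map_star, star_fdPotential])
    (by rw [← map_mul, fdPotential_commute, map_mul])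
    (fun j hj => by
      rw [Function.iterate_succ_apply', ← map_mul, ← map_mul, ← map_sub, Complex.ofReal_natCast,
        ← map_smul, shiftMatrix_comm_fdPotential (hV4 j hj.le).1, map_mul])
    (fun j hj v => (ContinuousLinearMap.le_opNorm _ _).trans (by
      rw [Matrix.l2_opNorm_toEuclideanCLM]
      gcongr
      exact norm_fdPotential_le hK fun x => by simpa using (hV4 j hj).2.2 0 (Nat.zero_le _) x))
    hK h1 h2 h3
  rw [fdLaplacian_eq]
  simp only [map_smul, map_sub, map_star, map_one, map_ofNat]
  simpa using this

theorem norm_shiftMatrix_le : ‖shiftMatrix n‖ ≤ 1 :=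
  (CStarRing.norm_of_mem_unitary
    (Unitary.mem_iff.2 ⟨star_mul_shiftMatrix (n := n), shiftMatrix_mul_star⟩)).le

theorem norm_fdLaplacian_le : ‖fdLaplacian n‖ ≤ 4 * (n : ℝ) ^ 2 := by
  have hS := norm_shiftMatrix_le (n := n)
  rw [fdLaplacian_eq, norm_smul, ← one_add_one_eq_two (R := Matrix (Fin n) (Fin n) ℂ)]
  have h : ‖(1 + 1 - shiftMatrix n - star (shiftMatrix n) : Matrix (Fin n) (Fin n) ℂ)‖ ≤ 4 := by
    refine (norm_sub_le _ _).trans ?_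
    refine (add_le_add ((norm_sub_le _ _).trans (add_le_add (norm_add_le _ _) hS))
      ((norm_star _).trans_le hS)).trans ?_
    rw [CStarRing.norm_one]
    norm_num
  calc _ ≤ ‖(n : ℂ) ^ 2‖ * 4 := by gcongr
    _ = _ := by simp [mul_comm]

end Potential

/-! ### Uniform bounds for the controls in terms of `m` and `K`. -/

section SmoothControls

/-- On `[0, T]`, `f` and its derivative `f'` are bounded by `κ`, and `f'` is Lipschitz with
constant `κ`. -/
structure SmoothControl (f f' : ℝ → ℝ) (T κ : ℝ) : Prop where
  hasDeriv : ∀ t ∈ Set.Icc 0 T, HasDerivWithinAt f (f' t) (Set.Icc 0 T) t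
  abs_le : ∀ t ∈ Set.Icc 0 T, |f t| ≤ κ
  abs_deriv_le : ∀ t ∈ Set.Icc 0 T, |f' t| ≤ κ
  lipschitz_deriv : ∀ x ∈ Set.Icc 0 T, ∀ y ∈ Set.Icc 0 T, |f' x - f' y| ≤ κ * |x - y|

variable {f f' g g' : ℝ → ℝ} {T κ μ : ℝ}

namespace SmoothControl

theorem lipschitz (hf : SmoothControl f f' T κ) :
    ∀ x ∈ Set.Icc 0 T, ∀ y ∈ Set.Icc 0 T, |f x - f y| ≤ κ * |x - y| := fun _ hx _ hy =>
  Convex.norm_image_sub_le_of_norm_hasDerivWithin_le hf.hasDeriv hf.abs_deriv_le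
    (convex_Icc 0 T) hy hx

theorem mono (hf : SmoothControl f f' T κ) (h : κ ≤ μ) : SmoothControl f f' T μ :=
  ⟨hf.hasDeriv, fun t ht => (hf.abs_le t ht).trans h, fun t ht => (hf.abs_deriv_le t ht).trans h,
    fun x hx y hy => (hf.lipschitz_deriv x hx y hy).trans (by gcongr)⟩

theorem div_two (hf : SmoothControl f f' T κ) :
    SmoothControl (fun t => f t / 2) (fun t => f' t / 2) T κ := by
  have h2 : |(2 : ℝ)| = 2 := abs_two
  refine ⟨fun t ht => (hf.hasDeriv t ht).div_const 2, fun t ht => ?_, fun t ht => ?_,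
    fun x hx y hy => ?_⟩
  · rw [abs_div, h2]
    linarith [hf.abs_le t ht, abs_nonneg (f t)]
  · rw [abs_div, h2]
    linarith [hf.abs_deriv_le t ht, abs_nonneg (f' t)]
  · rw [← sub_div, abs_div, h2]
    linarith [hf.lipschitz_deriv x hx y hy, abs_nonneg (f' x - f' y)]

theorem abs_mul_sub_mul_le {a b c d α β x : ℝ} (hα : 0 ≤ α) (hd : |d| ≤ β)
    (ha : |a| ≤ α) (hac : |a - c| ≤ α * x) (hbd : |b - d| ≤ β * x) :
    |a * b - c * d| ≤ 2 * (α * β) * x := by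
  have e : a * b - c * d = a * (b - d) + (a - c) * d := by ring
  have hβ : 0 ≤ β := (abs_nonneg _).trans hd
  have h0 : 0 ≤ α * x := (abs_nonneg _).trans hac
  calc _ ≤ |a| * |b - d| + |a - c| * |d| := by
        rw [e, ← abs_mul, ← abs_mul]; exact abs_add_le _ _
    _ ≤ α * (β * x) + (α * x) * β := by gcongr
    _ = _ := by ring

theorem mul (hf : SmoothControl f f' T κ) (hg : SmoothControl g g' T μ) (hκ : 0 ≤ κ)
    (hμ : 0 ≤ μ) :
    SmoothControl (fun t => f t * g t) (fun t => f' t * g t + f t * g' t) T (4 * (κ * μ)) := by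
  have hκμ : 0 ≤ κ * μ := mul_nonneg hκ hμ
  refine ⟨fun t ht => (hf.hasDeriv t ht).mul (hg.hasDeriv t ht), fun t ht => ?_, fun t ht => ?_,
    fun x hx y hy => ?_⟩
  · rw [abs_mul]
    have := mul_le_mul (hf.abs_le t ht) (hg.abs_le t ht) (abs_nonneg _) hκ
    linarith
  · refine (abs_add_le _ _).trans ?_
    rw [abs_mul, abs_mul]
    have h1 := mul_le_mul (hf.abs_deriv_le t ht) (hg.abs_le t ht) (abs_nonneg _) hκ
    have h2 := mul_le_mul (hf.abs_le t ht) (hg.abs_deriv_le t ht) (abs_nonneg _) hκ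
    linarith
  · have h1 := abs_mul_sub_mul_le hκ (hg.abs_le y hy) (hf.abs_deriv_le x hx)
      (hf.lipschitz_deriv x hx y hy) (hg.lipschitz x hx y hy)
    have h2 := abs_mul_sub_mul_le hκ (hg.abs_deriv_le y hy) (hf.abs_le x hx)
      (hf.lipschitz x hx y hy) (hg.lipschitz_deriv x hx y hy)
    rw [add_sub_add_comm]
    refine (abs_add_le _ _).trans ?_
    linarith

/-- The derivative is `-f' · f⁻¹ · f⁻¹`; its Lipschitz bound follows by applying the product
estimate twice. -/
theorem inv (hf : SmoothControl f f' T κ) (hκ : 0 ≤ κ) {m : ℝ} (hm : 0 < m)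
    (hfm : ∀ t ∈ Set.Icc 0 T, m ≤ f t) :
    SmoothControl (fun t => (f t)⁻¹) (fun t => -f' t / f t ^ 2) T
      (1 / m + 4 * κ * (1 / m + κ / m ^ 2) ^ 2 + κ / m ^ 2) := by
  have hpos : ∀ t ∈ Set.Icc 0 T, 0 < f t := fun t ht => hm.trans_le (hfm t ht)
  have hinv : ∀ t ∈ Set.Icc 0 T, |(f t)⁻¹| ≤ 1 / m := fun t ht => by
    rw [abs_inv, abs_of_pos (hpos t ht), ← one_div]
    exact one_div_le_one_div_of_le hm (hfm t ht)
  have h0 : 0 ≤ κ / m ^ 2 := by positivity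
  have h1 : 0 ≤ 4 * κ * (1 / m + κ / m ^ 2) ^ 2 := by positivity
  have hm' : 0 ≤ 1 / m := by positivity
  have hder : ∀ t ∈ Set.Icc 0 T,
      HasDerivWithinAt (fun t => (f t)⁻¹) (-f' t / f t ^ 2) (Set.Icc 0 T) t :=
    fun t ht => (hf.hasDeriv t ht).fun_inv (hpos t ht).ne'
  have hd : ∀ t ∈ Set.Icc 0 T, |-f' t / f t ^ 2| ≤ κ / m ^ 2 := fun t ht => by
    rw [abs_div, abs_neg, abs_of_pos (pow_pos (hpos t ht) 2)]
    exact div_le_div₀ hκ (hf.abs_deriv_le t ht) (by positivity)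
      (pow_le_pow_left₀ hm.le (hfm t ht) 2)
  refine ⟨hder, fun t ht => ?_, fun t ht => ?_, fun x hx y hy => ?_⟩
  · linarith [hinv t ht]
  · linarith [hd t ht]
  · set α := 1 / m + κ / m ^ 2 with hα
    have hα0 : 0 ≤ α := by positivity
    have hl : |(f x)⁻¹ - (f y)⁻¹| ≤ α * |x - y| := by
      refine (Convex.norm_image_sub_le_of_norm_hasDerivWithin_le hder hd
        (convex_Icc 0 T) hy hx).trans ?_
      rw [Real.norm_eq_abs]
      gcongr
      linarith
    have hb : ∀ t ∈ Set.Icc 0 T, |(f t)⁻¹| ≤ α := fun t ht => (hinv t ht).trans (by linarith)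
    have q1 := abs_mul_sub_mul_le hα0 (hb y hy) (hb x hx) hl hl
    have hbb : |(f y)⁻¹ * (f y)⁻¹| ≤ 2 * (α * α) := by
      rw [abs_mul]
      have := mul_le_mul (hb y hy) (hb y hy) (abs_nonneg _) hα0
      nlinarith
    have q2 := abs_mul_sub_mul_le hκ hbb (hf.abs_deriv_le x hx) (hf.lipschitz_deriv x hx y hy) q1
    have e : -f' x / f x ^ 2 - -f' y / f y ^ 2 =
        -(f' x * ((f x)⁻¹ * (f x)⁻¹) - f' y * ((f y)⁻¹ * (f y)⁻¹)) := by
      rw [div_eq_mul_inv, div_eq_mul_inv, pow_two, pow_two, mul_inv, mul_inv]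
      ring
    rw [e, abs_neg]
    refine q2.trans ?_
    gcongr
    nlinarith

/-- The constant continuation of a smooth control beyond `[0, T]`. -/
theorem controlBounds (hf : SmoothControl f f' T κ) (hT : 0 ≤ T) (hκ : 0 ≤ κ) :
    ControlBounds (fun x => f (Set.projIcc 0 T hT x)) T κ where
  abs_le x := hf.abs_le _ (Set.projIcc 0 T hT x).2
  lipschitz x y := (hf.lipschitz _ (Set.projIcc 0 T hT x).2 _ (Set.projIcc 0 T hT y).2).trans
    (mul_le_mul_of_nonneg_left (Set.abs_projIcc_sub_projIcc hT) hκ)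
  taylor := ⟨f', fun x hx y hy => by
    simp only [Set.projIcc_of_mem hT hx, Set.projIcc_of_mem hT hy]
    have hsub : Set.uIcc y x ⊆ Set.Icc 0 T := Set.uIcc_subset_Icc hy hx
    have := Convex.norm_image_sub_le_of_norm_hasDerivWithin_le (s := Set.uIcc y x)
      (f := fun s => f s - f' y * s) (f' := fun s => f' s - f' y * 1) (C := κ * |x - y|) (x := y)
      (y := x) (fun s hs => ((hf.hasDeriv s (hsub hs)).mono hsub).sub
        ((hasDerivWithinAt_id s _).const_mul (f' y)))
      (fun s hs => by
        rw [mul_one]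
        refine (hf.lipschitz_deriv s (hsub hs) y hy).trans ?_
        exact mul_le_mul_of_nonneg_left (Set.abs_sub_left_of_mem_uIcc hs) hκ)
      (convex_uIcc y x) Set.left_mem_uIcc Set.right_mem_uIcc
    rw [Real.norm_eq_abs, Real.norm_eq_abs, mul_assoc, abs_mul_abs_self, ← pow_two] at this
    convert this using 2
    ring⟩

end SmoothControl

theorem BoundedC2.smoothControl {K : ℝ} (hT : 0 < T) (hf : BoundedC2 K T f) :
    SmoothControl f (derivWithin f (Set.Icc 0 T)) T K := by
  obtain ⟨hc, hb⟩ := hf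
  have hu : UniqueDiffOn ℝ (Set.Icc 0 T) := uniqueDiffOn_Icc hT
  have hd1 : ∀ t ∈ Set.Icc 0 T, |derivWithin f (Set.Icc 0 T) t| ≤ K := fun t ht => by
    have := hb 1 (by norm_num) t ht
    rwa [iteratedDerivWithin_one] at this
  have hder2 : ContDiffOn ℝ 1 (derivWithin f (Set.Icc 0 T)) (Set.Icc 0 T) :=
    hc.derivWithin hu (by norm_num)
  refine ⟨fun t ht => ((hc.differentiableOn (by norm_num)) t ht).hasDerivWithinAt, fun t ht => ?_,
    hd1, fun x hx y hy => ?_⟩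
  · simpa using hb 0 (by norm_num) t ht
  · refine Convex.norm_image_sub_le_of_norm_hasDerivWithin_le
      (f' := derivWithin (derivWithin f (Set.Icc 0 T)) (Set.Icc 0 T))
      (fun s hs => ((hder2.differentiableOn (by norm_num)) s hs).hasDerivWithinAt) (fun s hs => ?_)
      (convex_Icc 0 T) hy hx
    have := hb 2 le_rfl s hs
    rwa [iteratedDerivWithin_succ, iteratedDerivWithin_one] at this

/-- The constant is chosen before `T`, `M` and `ω`; this makes the final constants depend on `m` and
`K` alone. -/
theorem exists_smoothControl {m K : ℝ} (hm : 0 < m) (hK : 0 < K) :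
    ∃ κ : ℝ, ∀ (T : ℝ) (_ : 0 < T) (M ω : ℝ → ℝ) (_ : ∀ t ∈ Set.Icc 0 T, m ≤ M t)
      (_ : BoundedC2 K T M) (_ : BoundedC2 K T ω),
      (∃ g, SmoothControl (kineticControl M) g T κ) ∧
        ∃ g, SmoothControl (potentialControl M ω) g T κ := by
  refine ⟨max (1 / m + 4 * K * (1 / m + K / m ^ 2) ^ 2 + K / m ^ 2)
    (4 * (K * (4 * (K * K)))), fun T hT M ω hMm hM hω => ⟨?_, ?_⟩⟩
  · have h := ((hM.smoothControl hT).inv hK.le hm hMm).div_two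
    have e : kineticControl M = fun t => (M t)⁻¹ / 2 := by
      ext t
      rw [kineticControl, one_div, mul_inv, mul_comm, div_eq_mul_inv]
    rw [e]
    exact ⟨_, h.mono (le_max_left _ _)⟩
  · have h := ((hM.smoothControl hT).mul
      ((hω.smoothControl hT).mul (hω.smoothControl hT) hK.le hK.le) hK.le (by positivity)).div_two
    have e : potentialControl M ω = fun t => M t * (ω t * ω t) / 2 := by
      ext t
      rw [potentialControl, pow_two]
    rw [e]
    exact ⟨_, h.mono (le_max_right _ _)⟩

end SmoothControls

/-! ### Accumulation of local errors. -/

section Global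

variable {n : ℕ}

theorem toEuclideanCLM_exp (X : Matrix (Fin n) (Fin n) ℂ) (c : ℂ) (r : ℝ)
    (hc : c = -Complex.I * (r : ℂ)) :
    Matrix.toEuclideanCLM (𝕜 := ℂ) (NormedSpace.exp (c • X)) =
      propagator (Matrix.toEuclideanCLM (𝕜 := ℂ) X) r := by
  have hcont : Continuous (Matrix.toEuclideanCLM (n := Fin n) (𝕜 := ℂ)) :=
    (AddMonoidHomClass.isometry_of_norm (Matrix.toEuclideanCLM (n := Fin n) (𝕜 := ℂ))
      fun A => Matrix.l2_opNorm_toEuclideanCLM A).continuous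
  let : NormedAlgebra ℚ (Matrix (Fin n) (Fin n) ℂ) := NormedAlgebra.restrictScalars ℚ ℂ _
  let : NormedAlgebra ℚ (EuclideanSpace ℂ (Fin n) →L[ℂ] EuclideanSpace ℂ (Fin n)) :=
    NormedAlgebra.restrictScalars ℚ ℂ _
  rw [NormedSpace.map_exp _ hcont, map_smul, hc]
  rfl

/-- Each step transports the previous error isometrically and adds one local error, taken at the
exact solution. No regularity of the numerical solution enters. -/
theorem norm_iterateSteps_sub_le {step : ℝ → ℝ → Matrix (Fin n) (Fin n) ℂ} {h δ : ℝ} {L : ℕ}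
    {ψ : ℝ → EuclideanSpace ℂ (Fin n)}
    (hstep : ∀ l < L, ∀ v, ‖Matrix.toEuclideanCLM (𝕜 := ℂ) (step (l * h) h) v‖ = ‖v‖)
    (hloc : ∀ l < L, ‖Matrix.toEuclideanCLM (𝕜 := ℂ) (step (l * h) h) (ψ (l * h))
      - ψ (l * h + h)‖ ≤ δ) :
    ∀ l ≤ L, ‖Matrix.toEuclideanCLM (𝕜 := ℂ) (iterateSteps step h l) (ψ 0) - ψ (l * h)‖ ≤ l * δ := by
  intro l
  induction l with
  | zero => intro _; simp [iterateSteps]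
  | succ l ih =>
    intro hl
    have h1 := ih (by omega)
    have h2 := hloc l (by omega)
    rw [← hstep l (by omega), map_sub] at h1
    have h3 := norm_sub_le_norm_sub_add_norm_sub
      (Matrix.toEuclideanCLM (𝕜 := ℂ) (step (l * h) h)
        (Matrix.toEuclideanCLM (𝕜 := ℂ) (iterateSteps step h l) (ψ 0)))
      (Matrix.toEuclideanCLM (𝕜 := ℂ) (step (l * h) h) (ψ (l * h))) (ψ (l * h + h))
    rw [iterateSteps, map_mul]
    push_cast
    rw [add_mul, one_mul, add_mul, one_mul]
    exact h3.trans (add_le_add h1 h2)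

theorem norm_numEvolution_sub_le {step : ℝ → ℝ → Matrix (Fin n) (Fin n) ℂ} {T δ : ℝ} {L : ℕ}
    {ψ : ℝ → EuclideanSpace ℂ (Fin n)} (hT : 0 < T) (hL : 0 < L)
    (hstep : ∀ t, 0 ≤ t → t + T / L ≤ T → ∀ v,
      ‖Matrix.toEuclideanCLM (𝕜 := ℂ) (step t (T / L)) v‖ = ‖v‖)
    (hloc : ∀ t, 0 ≤ t → t + T / L ≤ T →
      ‖Matrix.toEuclideanCLM (𝕜 := ℂ) (step t (T / L)) (ψ t) - ψ (t + T / L)‖ ≤ δ) :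
    ‖Matrix.toEuclideanCLM (𝕜 := ℂ) (numEvolution step T L) (ψ 0) - ψ T‖ ≤ L * δ := by
  have hL' : (0 : ℝ) < L := Nat.cast_pos.2 hL
  have hr : ∀ l < L, (0 : ℝ) ≤ l * (T / L) ∧ (l : ℝ) * (T / L) + T / L ≤ T := fun l hl => by
    refine ⟨by positivity, ?_⟩
    have : ((l : ℝ) + 1) ≤ L := by exact_mod_cast hl
    calc (l : ℝ) * (T / L) + T / L = (l + 1) * (T / L) := by ring
      _ ≤ L * (T / L) := by gcongr
      _ = T := by field_simp
  have := norm_iterateSteps_sub_le (step := step) (h := T / L) (ψ := ψ)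
    (fun l hl => hstep _ (hr l hl).1 (hr l hl).2) (fun l hl => hloc _ (hr l hl).1 (hr l hl).2)
    L le_rfl
  rwa [mul_div_cancel₀ _ hL'.ne'] at this

/-- Common source of both parts of the result, which differ only in the bound `a` for `‖A ψ(t)‖`.
The extensions `g₁`, `g₂` supply bounds on all of `ℝ`; the schemes see only times in `[0, T]`, where
they agree with `f₁`, `f₂`. -/
theorem norm_numEvolution_sub_le_all {A B : Matrix (Fin n) (Fin n) ℂ}
    {D : EuclideanSpace ℂ (Fin n) →L[ℂ] EuclideanSpace ℂ (Fin n)} {κ T a s : ℝ}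
    (h : CommutatorBounds (Matrix.toEuclideanCLM (𝕜 := ℂ) A) (Matrix.toEuclideanCLM (𝕜 := ℂ) B) D κ)
    {f₁ f₂ g₁ g₂ : ℝ → ℝ} (hg₁ : ControlBounds g₁ T κ) (hg₂ : ControlBounds g₂ T κ)
    (e₁ : Set.EqOn f₁ g₁ (Set.Icc 0 T)) (e₂ : Set.EqOn f₂ g₂ (Set.Icc 0 T)) (hT : 0 < T) {L : ℕ}
    (hL : T ≤ L) {ψ : ℝ → EuclideanSpace ℂ (Fin n)}
    (hψ : ∀ t ∈ Set.Icc 0 T, HasDerivWithinAt ψ (-Complex.I •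
      Matrix.toEuclideanCLM (𝕜 := ℂ) (hamiltonian f₁ f₂ A B t) (ψ t)) (Set.Icc 0 T) t)
    (ha : ∀ t ∈ Set.Icc 0 T, ‖Matrix.toEuclideanCLM (𝕜 := ℂ) A (ψ t)‖ ≤ a) (hs : ‖ψ 0‖ ≤ s) :
    ‖Matrix.toEuclideanCLM (𝕜 := ℂ) (numEvolution (stepS1 f₁ f₂ A B) T L) (ψ 0) - ψ T‖
        ≤ 10 * κ ^ 7 * (T ^ 2 / L) * (a + s) ∧
      ‖Matrix.toEuclideanCLM (𝕜 := ℂ) (numEvolution (stepG1 f₁ f₂ A B) T L) (ψ 0) - ψ T‖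
        ≤ 4 * κ ^ 7 * (T ^ 2 / L) * (√(a * s) + s) ∧
      ‖Matrix.toEuclideanCLM (𝕜 := ℂ) (numEvolution (stepS2 f₁ f₂ A B) T L) (ψ 0) - ψ T‖
        ≤ 35 * κ ^ 8 * (T ^ 3 / (L : ℝ) ^ 2) * (a + s) ∧
      ‖Matrix.toEuclideanCLM (𝕜 := ℂ) (numEvolution (stepG2 f₁ f₂ A B) T L) (ψ 0) - ψ T‖
        ≤ 25 * κ ^ 8 * (T ^ 3 / (L : ℝ) ^ 2) * (a + s) := by
  have hL' : (0 : ℝ) < L := hT.trans_le hL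
  have hLn : 0 < L := Nat.cast_pos.1 hL'
  have hκ : 0 ≤ κ := zero_le_one.trans h.one_le
  set τ := T / L with hτdef
  have hτ : 0 ≤ τ := by positivity
  have hτ1 : τ ≤ 1 := div_le_one_of_le₀ hL hL'.le
  set A' := Matrix.toEuclideanCLM (𝕜 := ℂ) A with hA'
  set B' := Matrix.toEuclideanCLM (𝕜 := ℂ) B with hB'
  have hψ' : ∀ t ∈ Set.Icc 0 T, HasDerivWithinAt ψ
      (-Complex.I • ((g₁ t : ℂ) • A' + (g₂ t : ℂ) • B') (ψ t)) (Set.Icc 0 T) t := fun t ht => by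
    have := hψ t ht
    rwa [hamiltonian, map_add, map_smul, map_smul, e₁ ht, e₂ ht] at this
  have hloc : ∀ t, 0 ≤ t → t + τ ≤ T → ∀ x ∈ Set.Icc t (t + τ), HasDerivWithinAt ψ
      (-Complex.I • ((g₁ x : ℂ) • A' + (g₂ x : ℂ) • B') (ψ x)) (Set.Icc t (t + τ)) x :=
    fun t ht0 htT x hx => (hψ' x ⟨ht0.trans hx.1, hx.2.trans htT⟩).mono
      (Set.Icc_subset_Icc ht0 htT)
  have hnorm : ∀ t ∈ Set.Icc 0 T, ‖ψ t‖ ≤ s := fun t ht => by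
    have := norm_le_of_hasDerivWithinAt_selfAdjoint (e := ψ) (g := fun _ => 0) (r := 0) hT.le
      (fun x _ => isSelfAdjoint_hamiltonian h.selfAdjoint_left h.selfAdjoint_right (g₁ x) (g₂ x))
      (fun x hx => by rw [add_zero]; exact hψ' x hx) (fun _ _ => by simp) t ht
    linarith
  have hmem : ∀ {t x}, 0 ≤ t → t + τ ≤ T → x ∈ Set.Icc t (t + τ) → x ∈ Set.Icc 0 T :=
    fun ht0 htT hx => ⟨ht0.trans hx.1, hx.2.trans htT⟩
  have hint : ∀ {f g : ℝ → ℝ}, Set.EqOn f g (Set.Icc 0 T) → ∀ {x y}, x ∈ Set.Icc 0 T →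
      y ∈ Set.Icc 0 T → ∫ r in x..y, f r = ∫ r in x..y, g r := fun he _ _ hx hy =>
    intervalIntegral.integral_congr fun r hr => he (Set.uIcc_subset_Icc hx hy hr)
  have hmid : ∀ {t : ℝ}, t + τ / 2 ∈ Set.Icc t (t + τ) := ⟨by linarith, by linarith⟩
  have hlast : ∀ {t : ℝ}, t + τ ∈ Set.Icc t (t + τ) := ⟨by linarith, le_rfl⟩
  have hfirst : ∀ {t : ℝ}, t ∈ Set.Icc t (t + τ) := ⟨le_rfl, by linarith⟩
  have hS1 : ∀ t, 0 ≤ t → t + τ ≤ T → ∀ v,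
      Matrix.toEuclideanCLM (𝕜 := ℂ) (stepS1 f₁ f₂ A B t τ) v =
        propagator B' (τ * g₂ (t + τ)) (propagator A' (τ * g₁ (t + τ)) v) := fun t ht0 htT v => by
    have hm := hmem ht0 htT hlast
    rw [stepS1, map_mul, e₁ hm, e₂ hm, toEuclideanCLM_exp A _ (τ * g₁ (t + τ)) (by push_cast; ring),
      toEuclideanCLM_exp B _ (τ * g₂ (t + τ)) (by push_cast; ring)]
    rfl
  have hG1 : ∀ t, 0 ≤ t → t + τ ≤ T → ∀ v,
      Matrix.toEuclideanCLM (𝕜 := ℂ) (stepG1 f₁ f₂ A B t τ) v =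
        propagator B' (∫ r in t..(t + τ), g₂ r) (propagator A' (∫ r in t..(t + τ), g₁ r) v) :=
    fun t ht0 htT v => by
    have hm := hmem ht0 htT hlast
    have hm' := hmem ht0 htT hfirst
    rw [stepG1, map_mul, hint e₁ hm' hm, hint e₂ hm' hm, toEuclideanCLM_exp A _ _ rfl,
      toEuclideanCLM_exp B _ _ rfl]
    rfl
  have hS2 : ∀ t, 0 ≤ t → t + τ ≤ T → ∀ v,
      Matrix.toEuclideanCLM (𝕜 := ℂ) (stepS2 f₁ f₂ A B t τ) v =
        propagator A' (τ / 2 * g₁ (t + τ / 2)) (propagator B' (τ * g₂ (t + τ / 2))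
          (propagator A' (τ / 2 * g₁ (t + τ / 2)) v)) := fun t ht0 htT v => by
    have hm := hmem ht0 htT hmid
    rw [stepS2, map_mul, map_mul, e₁ hm, e₂ hm,
      toEuclideanCLM_exp A _ (τ / 2 * g₁ (t + τ / 2)) (by push_cast; ring),
      toEuclideanCLM_exp B _ (τ * g₂ (t + τ / 2)) (by push_cast; ring)]
    rfl
  have hG2 : ∀ t, 0 ≤ t → t + τ ≤ T → ∀ v,
      Matrix.toEuclideanCLM (𝕜 := ℂ) (stepG2 f₁ f₂ A B t τ) v =
        propagator A' (∫ r in (t + τ / 2)..(t + τ), g₁ r) (propagator B' (∫ r in t..(t + τ), g₂ r)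
          (propagator A' (∫ r in t..(t + τ / 2), g₁ r) v)) := fun t ht0 htT v => by
    have hm := hmem ht0 htT hlast
    have hm' := hmem ht0 htT hfirst
    have hm'' := hmem ht0 htT hmid
    rw [stepG2, map_mul, map_mul, hint e₁ hm'' hm, hint e₂ hm' hm, hint e₁ hm' hm'',
      toEuclideanCLM_exp A _ _ rfl, toEuclideanCLM_exp B _ _ rfl, toEuclideanCLM_exp A _ _ rfl]
    rfl
  have t2 : (L : ℝ) * τ ^ 2 = T ^ 2 / L := by rw [hτdef]; field_simp
  have t3 : (L : ℝ) * τ ^ 3 = T ^ 3 / (L : ℝ) ^ 2 := by rw [hτdef]; field_simp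
  have has : ∀ t, 0 ≤ t → t + τ ≤ T → ‖A' (ψ t)‖ + ‖ψ t‖ ≤ a + s := fun t ht0 htT =>
    add_le_add (ha t (hmem ht0 htT hfirst)) (hnorm t (hmem ht0 htT hfirst))
  refine ⟨?_, ?_, ?_, ?_⟩
  · refine (norm_numEvolution_sub_le hT hLn (δ := 10 * κ ^ 7 * τ ^ 2 * (a + s))
      (fun t ht0 htT v => ?_) (fun t ht0 htT => ?_)).trans_eq (by rw [← t2]; ring)
    · rw [hS1 t ht0 htT, norm_propagator_apply h.selfAdjoint_right,
        norm_propagator_apply h.selfAdjoint_left]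
    · rw [hS1 t ht0 htT]
      refine (norm_standardStep_one_sub_le h hg₁ hg₂ hτ hτ1 (hloc t ht0 htT)).trans ?_
      gcongr ?_ * ?_
      exact has t ht0 htT
  · refine (norm_numEvolution_sub_le hT hLn (δ := 4 * κ ^ 7 * τ ^ 2 * (√(a * s) + s))
      (fun t ht0 htT v => ?_) (fun t ht0 htT => ?_)).trans_eq (by rw [← t2]; ring)
    · rw [hG1 t ht0 htT, norm_propagator_apply h.selfAdjoint_right,
        norm_propagator_apply h.selfAdjoint_left]
    · rw [hG1 t ht0 htT]
      refine (norm_generalizedStep_one_sub_le h hg₁ hg₂ hτ hτ1 (hloc t ht0 htT)).trans ?_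
      have hat := ha t (hmem ht0 htT hfirst)
      have hst := hnorm t (hmem ht0 htT hfirst)
      have ha0 : 0 ≤ a := (norm_nonneg _).trans hat
      gcongr
  · refine (norm_numEvolution_sub_le hT hLn (δ := 35 * κ ^ 8 * τ ^ 3 * (a + s))
      (fun t ht0 htT v => ?_) (fun t ht0 htT => ?_)).trans_eq (by rw [← t3]; ring)
    · rw [hS2 t ht0 htT, norm_propagator_apply h.selfAdjoint_left,
        norm_propagator_apply h.selfAdjoint_right, norm_propagator_apply h.selfAdjoint_left]
    · rw [hS2 t ht0 htT]
      refine (norm_standardStep_two_sub_le h hg₁ hg₂ hτ hτ1 ht0 htT (hloc t ht0 htT)).trans ?_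
      gcongr ?_ * ?_
      exact has t ht0 htT
  · refine (norm_numEvolution_sub_le hT hLn (δ := 25 * κ ^ 8 * τ ^ 3 * (a + s))
      (fun t ht0 htT v => ?_) (fun t ht0 htT => ?_)).trans_eq (by rw [← t3]; ring)
    · rw [hG2 t ht0 htT, norm_propagator_apply h.selfAdjoint_left,
        norm_propagator_apply h.selfAdjoint_right, norm_propagator_apply h.selfAdjoint_left]
    · rw [hG2 t ht0 htT]
      refine (norm_generalizedStep_two_sub_le h hg₁ hg₂ hτ hτ1 (hloc t ht0 htT)).trans ?_
      gcongr ?_ * ?_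
      exact has t ht0 htT

end Global

/-! ### Truncation error of the central difference and regularity of the semi-discrete solution. -/

section Consistency

theorem norm_le_mul_pow_of_hasDerivAt {F : Type*} [NormedAddCommGroup F] [NormedSpace ℝ F]
    {k k' : ℝ → F} {C : ℝ} (hC : 0 ≤ C) {j : ℕ} (hk : ∀ s, HasDerivAt k (k' s) s) (h0 : k 0 = 0)
    (hk' : ∀ s, 0 ≤ s → ‖k' s‖ ≤ C * s ^ j) : ∀ s, 0 ≤ s → ‖k s‖ ≤ C * s ^ (j + 1) := by
  intro s hs
  have := Convex.norm_image_sub_le_of_norm_hasDerivWithin_le (s := Set.Icc 0 s) (f := k)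
    (C := C * s ^ j) (x := 0) (y := s) (fun x _ => (hk x).hasDerivWithinAt)
    (fun x hx => (hk' x hx.1).trans (by
      have := pow_le_pow_left₀ hx.1 hx.2 j
      gcongr)) (convex_Icc 0 s) ⟨le_rfl, hs⟩ ⟨hs, le_rfl⟩
  rw [h0, sub_zero, sub_zero, Real.norm_of_nonneg hs, mul_assoc, ← pow_succ] at this
  exact this

/-- Differentiation flips the sign `ε`. The combinations with `ε = -1` vanish at `s = 0`, so the odd
Taylor terms drop out of the second difference. -/
theorem hasDerivAt_iteratedDeriv_symm {u : ℝ → ℂ} (hu : ContDiff ℝ 4 u) (x : ℝ) (ε : ℂ) {j : ℕ} (hj : j < 4) (s : ℝ) :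
    HasDerivAt (fun s => iteratedDeriv j u (x + s) + ε * iteratedDeriv j u (x - s))
      (iteratedDeriv (j + 1) u (x + s) + -ε * iteratedDeriv (j + 1) u (x - s)) s := by
  have h : ∀ y, HasDerivAt (iteratedDeriv j u) (iteratedDeriv (j + 1) u y) y := fun y => by
    rw [iteratedDeriv_succ]
    exact ((hu.differentiable_iteratedDeriv j (by exact_mod_cast hj)) y).hasDerivAt
  refine (((h (x + s)).comp_const_add x s).add
    (((h (x - s)).comp_const_sub x s).const_mul ε)).congr_deriv ?_
  ring

theorem norm_secondDifference_le {u : ℝ → ℂ} (hu : ContDiff ℝ 4 u) {S₂ : ℝ}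
    (h2 : ∀ x, ‖iteratedDeriv 2 u x‖ ≤ S₂) (x : ℝ) {s : ℝ}
    (hs : 0 ≤ s) : ‖u (x + s) + u (x - s) - 2 * u x‖ ≤ 2 * S₂ * s ^ 2 := by
  have hS : 0 ≤ S₂ := (norm_nonneg _).trans (h2 0)
  have d0 := hasDerivAt_iteratedDeriv_symm hu x 1 (j := 0) (by norm_num)
  have d1 := hasDerivAt_iteratedDeriv_symm hu x (-1) (j := 1) (by norm_num)
  have b1 := norm_le_mul_pow_of_hasDerivAt (C := 2 * S₂) (j := 0) (by positivity) d1 (by simp)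
    fun s _ => by
      refine (norm_add_le _ _).trans ?_
      rw [norm_mul, neg_neg, norm_one, one_mul]
      linarith [h2 (x + s), h2 (x - s)]
  have b0 := norm_le_mul_pow_of_hasDerivAt (C := 2 * S₂) (j := 1) (by positivity)
    (fun s => (d0 s).sub_const (2 * u x)) (by simp; ring) b1 s hs
  simpa using b0

theorem norm_secondDifference_sub_le {u : ℝ → ℂ} (hu : ContDiff ℝ 4 u) {S₄ : ℝ}
    (h4 : ∀ x, ‖iteratedDeriv 4 u x‖ ≤ S₄) (x : ℝ)
    {s : ℝ} (hs : 0 ≤ s) :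
    ‖u (x + s) + u (x - s) - 2 * u x - s ^ 2 * iteratedDeriv 2 u x‖ ≤ 2 * S₄ * s ^ 4 := by
  have hS : 0 ≤ S₄ := (norm_nonneg _).trans (h4 0)
  have d0 := hasDerivAt_iteratedDeriv_symm hu x 1 (j := 0) (by norm_num)
  have d1 := hasDerivAt_iteratedDeriv_symm hu x (-1) (j := 1) (by norm_num)
  have d2 := hasDerivAt_iteratedDeriv_symm hu x 1 (j := 2) (by norm_num)
  have d3 := hasDerivAt_iteratedDeriv_symm hu x (-1) (j := 3) (by norm_num)
  set c := iteratedDeriv 2 u x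
  have hid : ∀ s : ℝ, HasDerivAt (fun s : ℝ => (s : ℂ)) 1 s := fun s =>
    Complex.ofRealCLM.hasDerivAt
  have hp1 : ∀ s : ℝ, HasDerivAt (fun s : ℝ => 2 * (s : ℂ) * c) (2 * c) s := fun s => by
    simpa using (((hid s).const_mul 2).mul_const c)
  have hp2 : ∀ s : ℝ, HasDerivAt (fun s : ℝ => (s : ℂ) ^ 2 * c) (2 * (s : ℂ) * c) s := fun s => by
    simpa using (((hid s).pow 2).mul_const c)
  have b3 := norm_le_mul_pow_of_hasDerivAt (C := 2 * S₄) (j := 0) (by positivity) d3 (by simp)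
    fun s _ => by
      refine (norm_add_le _ _).trans ?_
      rw [norm_mul, neg_neg, norm_one, one_mul]
      linarith [h4 (x + s), h4 (x - s)]
  have b2 := norm_le_mul_pow_of_hasDerivAt (C := 2 * S₄) (j := 1) (by positivity)
    (fun s => (d2 s).sub_const (2 * c)) (by simp [c]; ring) b3
  have b1 := norm_le_mul_pow_of_hasDerivAt (C := 2 * S₄) (j := 2) (by positivity)
    (fun s => ((d1 s).sub (hp1 s)).congr_deriv (by rw [neg_neg])) (by simp) b2
  have b0 := norm_le_mul_pow_of_hasDerivAt (C := 2 * S₄) (j := 3) (by positivity)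
    (fun s => ((d0 s).sub_const (2 * u x)).sub (hp2 s)) (by simp; ring) b1 s hs
  simpa using b0

variable {n : ℕ}

theorem norm_toLp_le {v : Fin n → ℂ} {c : ℝ} (hc : 0 ≤ c) (hv : ∀ k, ‖v k‖ ≤ c) :
    ‖WithLp.toLp 2 v‖ ≤ √(n : ℝ) * c := by
  rw [EuclideanSpace.norm_eq]
  refine Real.sqrt_le_iff.2 ⟨by positivity, ?_⟩
  rw [mul_pow, Real.sq_sqrt (Nat.cast_nonneg n)]
  calc ∑ i, ‖(WithLp.toLp 2 v : EuclideanSpace ℂ (Fin n)) i‖ ^ 2 ≤ ∑ _i : Fin n, c ^ 2 :=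
        Finset.sum_le_sum fun i _ => pow_le_pow_left₀ (norm_nonneg _) (hv i) 2
    _ = _ := by simp

theorem fdLaplacian_mulVec_sample [NeZero n] {u : ℝ → ℂ} (hu : Function.Periodic u 1) (k : Fin n) :
    (fdLaplacian n).mulVec (sample n u) k = (n : ℂ) ^ 2 *
      (2 * u ((k : ℕ) / (n : ℝ)) - u ((k : ℕ) / (n : ℝ) + 1 / n)
        - u ((k : ℕ) / (n : ℝ) - 1 / n)) := by
  have h1 := sample_add_one hu k
  have h2 : sample n u (k - 1) = u ((k : ℕ) / (n : ℝ) - 1 / n) := by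
    have hu' : Function.Periodic (fun x => u (x - 1 / n)) 1 := fun x => by
      change u (x + 1 - 1 / n) = u (x - 1 / n)
      rw [add_sub_right_comm, hu]
    have := sample_add_one hu' (k - 1)
    rw [sub_add_cancel, add_sub_cancel_right] at this
    exact this.symm
  rw [← h1, ← h2]
  have h3 : ∀ j : Fin n, k = j + 1 ↔ k - 1 = j := fun j => (sub_eq_iff_eq_add).symm
  rw [fdLaplacian, Matrix.smul_mulVec, Pi.smul_apply, smul_eq_mul]
  congr 1
  simp [Matrix.mulVec, dotProduct, sub_mul, h3, sample, Finset.sum_sub_distrib]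

theorem toEuclideanCLM_hamiltonian (f₁ f₂ : ℝ → ℝ) (A B : Matrix (Fin n) (Fin n) ℂ) (t : ℝ) :
    Matrix.toEuclideanCLM (𝕜 := ℂ) (hamiltonian f₁ f₂ A B t) =
      (f₁ t : ℂ) • Matrix.toEuclideanCLM (𝕜 := ℂ) A +
        (f₂ t : ℂ) • Matrix.toEuclideanCLM (𝕜 := ℂ) B := by
  rw [hamiltonian, map_add, map_smul, map_smul]

/-- Periodicity carries the bound from `[0, 1]` to all `x`; the difference stencil reaches outside
the unit interval. -/
theorem IsExactSolution.norm_iteratedDeriv_le {f₁ f₂ V : ℝ → ℝ} {T : ℝ} {φ : ℝ → ℝ → ℂ}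
    (hφ : IsExactSolution f₁ f₂ V T φ) {j : ℕ}
    (hb : BddAbove ((fun p : ℝ × ℝ => ‖iteratedDeriv j (φ p.1) p.2‖) ''
      (Set.Icc 0 T ×ˢ Set.Icc 0 1))) {t : ℝ} (ht : t ∈ Set.Icc 0 T) (x : ℝ) :
    ‖iteratedDeriv j (φ t) x‖ ≤ supDeriv j T φ := by
  have hp : Function.Periodic (iteratedDeriv j (φ t)) 1 := fun x => by
    have := congrFun (iteratedDeriv_comp_add_const j (φ t) 1) x
    rw [← this]
    congr 2
    exact funext (hφ.periodic t ht)
  obtain ⟨y, hy, hxy⟩ := hp.exists_mem_Ico₀ one_pos x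
  rw [hxy]
  exact le_csSup hb ⟨(t, y), ⟨ht, hy.1, hy.2.le⟩, rfl⟩

theorem hasDerivWithinAt_toLp {ψ : ℝ → Fin n → ℂ} {ψ' : Fin n → ℂ} {s : Set ℝ} {t : ℝ}
    (h : HasDerivWithinAt ψ ψ' s t) : HasDerivWithinAt
      (fun t => (WithLp.toLp 2 (ψ t) : EuclideanSpace ℂ (Fin n))) (WithLp.toLp 2 ψ') s t :=
  ((PiLp.continuousLinearEquiv 2 ℝ (fun _ : Fin n => ℂ)).symm :
    (Fin n → ℂ) →L[ℝ] EuclideanSpace ℂ (Fin n)).hasFDerivAt.comp_hasDerivWithinAt t h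

/-- The second differences of the semi-discrete solution are bounded uniformly in `n`. -/
theorem norm_fdLaplacian_solution_le [NeZero n] {f₁ f₂ V : ℝ → ℝ} {T κ : ℝ} {φ : ℝ → ℝ → ℂ}
    {ψ : ℝ → Fin n → ℂ} (hT : 0 ≤ T) (hκ : ∀ t ∈ Set.Icc 0 T, |f₁ t| ≤ κ)
    (hφ : IsExactSolution f₁ f₂ V T φ)
    (hA : IsSelfAdjoint (Matrix.toEuclideanCLM (𝕜 := ℂ) (fdLaplacian n)))
    (hB : IsSelfAdjoint (Matrix.toEuclideanCLM (𝕜 := ℂ) (fdPotential n V)))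
    (hψ : SolvesODE (hamiltonian f₁ f₂ (fdLaplacian n) (fdPotential n V)) T ψ)
    (h0 : ψ 0 = sample n (φ 0)) {t : ℝ} (ht : t ∈ Set.Icc 0 T) :
    ‖Matrix.toEuclideanCLM (𝕜 := ℂ) (fdLaplacian n) (WithLp.toLp 2 (ψ t))‖ ≤
      √(n : ℝ) * (2 * supDeriv 2 T φ + 8 * κ * T * supDeriv 4 T φ) := by
  have b4 := fun {t} (ht : t ∈ Set.Icc 0 T) => hφ.norm_iteratedDeriv_le hφ.bdd_four ht
  have b2 := fun {t} (ht : t ∈ Set.Icc 0 T) => hφ.norm_iteratedDeriv_le hφ.bdd_two ht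
  set S₄ := supDeriv 4 T φ
  set S₂ := supDeriv 2 T φ
  have hS₄ : 0 ≤ S₄ := (norm_nonneg _).trans (b4 ht 0)
  have hS₂ : 0 ≤ S₂ := (norm_nonneg _).trans (b2 ht 0)
  have hκ0 : 0 ≤ κ := (abs_nonneg _).trans (hκ t ht)
  have hn : (0 : ℝ) < n := Nat.cast_pos.2 (NeZero.pos n)
  have hnc : (n : ℂ) ≠ 0 := Nat.cast_ne_zero.2 (NeZero.ne n)
  have lap2 : ∀ k, ‖(fdLaplacian n).mulVec (sample n (φ t)) k‖ ≤ 2 * S₂ := fun k => by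
    have := norm_secondDifference_le (hφ.contDiff t ht) (b2 ht) ((k : ℕ) / (n : ℝ))
      (s := 1 / n) (by positivity)
    rw [fdLaplacian_mulVec_sample (hφ.periodic t ht), norm_mul, norm_pow, Complex.norm_natCast,
      ← norm_neg]
    calc _ ≤ (n : ℝ) ^ 2 * (2 * S₂ * (1 / n) ^ 2) := by
          gcongr
          refine Eq.trans_le ?_ this
          congr 1
          ring
      _ = _ := by field_simp
  have res : ∀ x ∈ Set.Icc 0 T, ∀ k, ‖(fdLaplacian n).mulVec (sample n (φ x)) k +
      sample n (iteratedDeriv 2 (φ x)) k‖ ≤ 2 * S₄ / n ^ 2 := fun x hx k => by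
    have := norm_secondDifference_sub_le (hφ.contDiff x hx) (b4 hx) ((k : ℕ) / (n : ℝ))
      (s := 1 / n) (by positivity)
    rw [fdLaplacian_mulVec_sample (hφ.periodic x hx), ← norm_neg]
    have e : -((n : ℂ) ^ 2 * (2 * φ x ((k : ℕ) / (n : ℝ)) - φ x ((k : ℕ) / (n : ℝ) + 1 / n)
        - φ x ((k : ℕ) / (n : ℝ) - 1 / n)) + sample n (iteratedDeriv 2 (φ x)) k) =
        (n : ℂ) ^ 2 * (φ x ((k : ℕ) / (n : ℝ) + 1 / n) + φ x ((k : ℕ) / (n : ℝ) - 1 / n)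
          - 2 * φ x ((k : ℕ) / (n : ℝ)) -
          ((1 / n : ℝ) : ℂ) ^ 2 * iteratedDeriv 2 (φ x) ((k : ℕ) / (n : ℝ))) := by
      rw [sample]
      push_cast
      field_simp
      ring
    rw [e, norm_mul, norm_pow, Complex.norm_natCast]
    calc _ ≤ (n : ℝ) ^ 2 * (2 * S₄ * (1 / n) ^ 4) := by gcongr
      _ = _ := by field_simp
  have hder : ∀ x ∈ Set.Icc 0 T, HasDerivWithinAt (fun x => ψ x - sample n (φ x))
      (-Complex.I • (hamiltonian f₁ f₂ (fdLaplacian n) (fdPotential n V) x).mulVec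
        (ψ x - sample n (φ x)) + (-Complex.I * (f₁ x : ℂ)) •
          ((fdLaplacian n).mulVec (sample n (φ x)) + sample n (iteratedDeriv 2 (φ x))))
      (Set.Icc 0 T) x := fun x hx => by
    have h1 : HasDerivWithinAt (fun x => sample n (φ x)) _ (Set.Icc 0 T) x :=
      hasDerivWithinAt_pi.2 fun k => hφ.equation x hx ((k : ℕ) / (n : ℝ))
    refine ((hψ x hx).sub h1).congr_deriv ?_
    ext k
    have hV : (fdPotential n V).mulVec (sample n (φ x)) k =
        (V ((k : ℕ) / (n : ℝ)) : ℂ) * φ x ((k : ℕ) / (n : ℝ)) := by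
      rw [fdPotential, Matrix.mulVec_diagonal]
      rfl
    rw [Matrix.mulVec_sub, hamiltonian, Matrix.add_mulVec, Matrix.add_mulVec, Matrix.smul_mulVec,
      Matrix.smul_mulVec, Matrix.smul_mulVec, Matrix.smul_mulVec]
    simp only [Pi.add_apply, Pi.sub_apply, Pi.smul_apply, smul_eq_mul, hV, sample]
    ring
  -- The source term is the truncation error, of size `n⁻²` at every node; `√n` passes from the
  -- maximum to the Euclidean norm.
  have energy := norm_le_of_hasDerivWithinAt_selfAdjoint
    (e := fun x => (WithLp.toLp 2 (ψ x - sample n (φ x)) : EuclideanSpace ℂ (Fin n)))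
    (H := fun x => (f₁ x : ℂ) • Matrix.toEuclideanCLM (𝕜 := ℂ) (fdLaplacian n) +
      (f₂ x : ℂ) • Matrix.toEuclideanCLM (𝕜 := ℂ) (fdPotential n V))
    (g := fun x => WithLp.toLp 2 ((-Complex.I * (f₁ x : ℂ)) •
          ((fdLaplacian n).mulVec (sample n (φ x)) + sample n (iteratedDeriv 2 (φ x)))))
    (r := √(n : ℝ) * (κ * (2 * S₄ / n ^ 2))) hT
    (fun x _ => isSelfAdjoint_hamiltonian hA hB _ _)
    (fun x hx => (hasDerivWithinAt_toLp (hder x hx)).congr_deriv (by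
      rw [← toEuclideanCLM_hamiltonian, Matrix.toEuclideanCLM_toLp, WithLp.toLp_add,
        WithLp.toLp_smul]))
    (fun x hx => norm_toLp_le (by positivity) fun k => by
      rw [Pi.smul_apply, norm_smul, norm_mul, norm_neg, Complex.norm_I, one_mul, Complex.norm_real]
      exact mul_le_mul (hκ x hx) (res x hx k) (norm_nonneg _) hκ0) t ht
  simp only [h0, sub_self, sub_zero, WithLp.toLp_zero, norm_zero, zero_add] at energy
  have split : Matrix.toEuclideanCLM (𝕜 := ℂ) (fdLaplacian n) (WithLp.toLp 2 (ψ t)) =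
      WithLp.toLp 2 ((fdLaplacian n).mulVec (sample n (φ t))) +
      Matrix.toEuclideanCLM (𝕜 := ℂ) (fdLaplacian n) (WithLp.toLp 2 (ψ t - sample n (φ t))) := by
    rw [← Matrix.toEuclideanCLM_toLp, ← map_add, ← WithLp.toLp_add, add_sub_cancel]
  -- The crude bound `‖A‖ ≤ 4 n²` is affordable here: it meets an error of order `n⁻²`.
  have q := (ContinuousLinearMap.le_opNorm (Matrix.toEuclideanCLM (𝕜 := ℂ) (fdLaplacian n))
    (WithLp.toLp 2 (ψ t - sample n (φ t))))
  rw [Matrix.l2_opNorm_toEuclideanCLM] at q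
  rw [split]
  calc _ ≤ √(n : ℝ) * (2 * S₂) + 4 * (n : ℝ) ^ 2 * (√(n : ℝ) * (κ * (2 * S₄ / n ^ 2)) * t) :=
        (norm_add_le _ _).trans (add_le_add (norm_toLp_le (by positivity) lap2)
          (q.trans (mul_le_mul norm_fdLaplacian_le energy (norm_nonneg _) (by positivity))))
    _ = √(n : ℝ) * (2 * S₂ + 8 * κ * t * S₄) := by field_simp; ring
    _ ≤ _ := by
        have := ht.2
        gcongr

end Consistency

/-! ### Operator-norm and vector-norm error bounds. -/

section Errors

theorem norm_toEuclideanCLM_sub_le {n : ℕ} {X Y : Matrix (Fin n) (Fin n) ℂ} {b : ℝ} (hb : 0 ≤ b)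
    (h : ∀ v, ‖Matrix.toEuclideanCLM (𝕜 := ℂ) X v - Matrix.toEuclideanCLM (𝕜 := ℂ) Y v‖
      ≤ b * ‖v‖) : ‖X - Y‖ ≤ b := by
  rw [← Matrix.l2_opNorm_toEuclideanCLM, map_sub]
  exact ContinuousLinearMap.opNorm_le_bound _ hb h

theorem IsEvolution.hasDerivWithinAt_apply {n : ℕ} {H U : ℝ → Matrix (Fin n) (Fin n) ℂ} {T : ℝ}
    (hU : IsEvolution H T U) (v : EuclideanSpace ℂ (Fin n)) {t : ℝ} (ht : t ∈ Set.Icc 0 T) :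
    HasDerivWithinAt (fun t => Matrix.toEuclideanCLM (𝕜 := ℂ) (U t) v)
      (-Complex.I • Matrix.toEuclideanCLM (𝕜 := ℂ) (H t) (Matrix.toEuclideanCLM (𝕜 := ℂ) (U t) v))
      (Set.Icc 0 T) t := by
  let ev : Matrix (Fin n) (Fin n) ℂ →L[ℝ] EuclideanSpace ℂ (Fin n) :=
    (LinearMap.toContinuousLinearMap
      { toFun := fun X => Matrix.toEuclideanCLM (𝕜 := ℂ) X v
        map_add' := fun X Y => by rw [map_add]; rfl
        map_smul' := fun c X => by rw [map_smul]; rfl } :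
      Matrix (Fin n) (Fin n) ℂ →L[ℂ] EuclideanSpace ℂ (Fin n)).restrictScalars ℝ
  refine (ev.hasFDerivAt.comp_hasDerivWithinAt t (hU.deriv t ht)).congr_deriv ?_
  change Matrix.toEuclideanCLM (𝕜 := ℂ) _ v = _
  rw [map_smul, map_mul]
  rfl

variable {n : ℕ} [NeZero n] {f₁ f₂ g₁ g₂ V : ℝ → ℝ} {T κ : ℝ}
  {D : EuclideanSpace ℂ (Fin n) →L[ℂ] EuclideanSpace ℂ (Fin n)}

/-- The global estimate is applied to every orbit `U(t) v`, with `‖A U(t) v‖ ≤ 4 n² ‖v‖`. -/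
theorem operator_error_le
    (h : CommutatorBounds (Matrix.toEuclideanCLM (𝕜 := ℂ) (fdLaplacian n))
      (Matrix.toEuclideanCLM (𝕜 := ℂ) (fdPotential n V)) D κ)
    (hg₁ : ControlBounds g₁ T κ) (hg₂ : ControlBounds g₂ T κ)
    (e₁ : Set.EqOn f₁ g₁ (Set.Icc 0 T)) (e₂ : Set.EqOn f₂ g₂ (Set.Icc 0 T)) (hT : 0 < T) {L : ℕ}
    (hL : T ≤ L) {U : ℝ → Matrix (Fin n) (Fin n) ℂ}
    (hU : IsEvolution (hamiltonian f₁ f₂ (fdLaplacian n) (fdPotential n V)) T U) :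
    ‖numEvolution (stepS1 f₁ f₂ (fdLaplacian n) (fdPotential n V)) T L - U T‖
        ≤ 50 * κ ^ 7 * ((n : ℝ) ^ 2 * T ^ 2 / L) ∧
      ‖numEvolution (stepG1 f₁ f₂ (fdLaplacian n) (fdPotential n V)) T L - U T‖
        ≤ 12 * κ ^ 7 * ((n : ℝ) * T ^ 2 / L) ∧
      ‖numEvolution (stepS2 f₁ f₂ (fdLaplacian n) (fdPotential n V)) T L - U T‖
        ≤ 175 * κ ^ 8 * ((n : ℝ) ^ 2 * T ^ 3 / (L : ℝ) ^ 2) ∧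
      ‖numEvolution (stepG2 f₁ f₂ (fdLaplacian n) (fdPotential n V)) T L - U T‖
        ≤ 125 * κ ^ 8 * ((n : ℝ) ^ 2 * T ^ 3 / (L : ℝ) ^ 2) := by
  have hκ : 0 ≤ κ := zero_le_one.trans h.one_le
  have hn : (1 : ℝ) ≤ n := by exact_mod_cast NeZero.one_le
  have hn2 : (1 : ℝ) ≤ (n : ℝ) ^ 2 := one_le_pow₀ hn
  have hU0 : ∀ v, Matrix.toEuclideanCLM (𝕜 := ℂ) (U 0) v = v := fun v => by
    rw [hU.init, map_one]; rfl
  have hnorm : ∀ (v : EuclideanSpace ℂ (Fin n)), ∀ t ∈ Set.Icc 0 T,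
      ‖Matrix.toEuclideanCLM (𝕜 := ℂ) (U t) v‖ ≤ ‖v‖ := fun v t ht => by
    have := norm_le_of_hasDerivWithinAt_selfAdjoint (g := fun _ => 0) (r := 0) hT.le
      (fun x _ => isSelfAdjoint_hamiltonian h.selfAdjoint_left h.selfAdjoint_right (f₁ x) (f₂ x))
      (fun x hx => by
        rw [add_zero, ← toEuclideanCLM_hamiltonian]
        exact hU.hasDerivWithinAt_apply v hx) (fun _ _ => by simp) t ht
    rwa [hU0, zero_mul, add_zero] at this
  have key := fun v : EuclideanSpace ℂ (Fin n) =>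
    norm_numEvolution_sub_le_all (a := 4 * (n : ℝ) ^ 2 * ‖v‖) (s := ‖v‖) h hg₁ hg₂ e₁ e₂ hT hL
      (ψ := fun t => Matrix.toEuclideanCLM (𝕜 := ℂ) (U t) v)
      (fun t ht => hU.hasDerivWithinAt_apply v ht)
      (fun t ht => (ContinuousLinearMap.le_opNorm _ _).trans (by
        rw [Matrix.l2_opNorm_toEuclideanCLM]
        exact mul_le_mul norm_fdLaplacian_le (hnorm v t ht) (norm_nonneg _) (by positivity)))
      (congrArg norm (hU0 v)).le
  have hsum : ∀ v : EuclideanSpace ℂ (Fin n),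
      4 * (n : ℝ) ^ 2 * ‖v‖ + ‖v‖ ≤ 5 * (n : ℝ) ^ 2 * ‖v‖ := fun v => by
    nlinarith [mul_le_mul_of_nonneg_right hn2 (norm_nonneg v)]
  -- The geometric mean of `4 n² ‖v‖` and `‖v‖` is `2 n ‖v‖`: this is the single power of `n` in the
  -- bound for `g,1`.
  have hsqrt : ∀ v : EuclideanSpace ℂ (Fin n),
      √(4 * (n : ℝ) ^ 2 * ‖v‖ * ‖v‖) + ‖v‖ ≤ 3 * n * ‖v‖ := fun v => by
    have e : 4 * (n : ℝ) ^ 2 * ‖v‖ * ‖v‖ = (2 * n * ‖v‖) ^ 2 := by ring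
    rw [e, Real.sqrt_sq (by positivity)]
    nlinarith [mul_le_mul_of_nonneg_right hn (norm_nonneg v)]
  refine ⟨norm_toEuclideanCLM_sub_le (by positivity) fun v => ?_,
    norm_toEuclideanCLM_sub_le (by positivity) fun v => ?_,
    norm_toEuclideanCLM_sub_le (by positivity) fun v => ?_,
    norm_toEuclideanCLM_sub_le (by positivity) fun v => ?_⟩
  · have k := (key v).1
    rw [hU0 v] at k
    calc _ ≤ _ := k
      _ ≤ 10 * κ ^ 7 * (T ^ 2 / L) * (5 * (n : ℝ) ^ 2 * ‖v‖) := by gcongr; exact hsum v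
      _ = _ := by ring
  · have k := (key v).2.1
    rw [hU0 v] at k
    calc _ ≤ _ := k
      _ ≤ 4 * κ ^ 7 * (T ^ 2 / L) * (3 * n * ‖v‖) := by gcongr; exact hsqrt v
      _ = _ := by ring
  · have k := (key v).2.2.1
    rw [hU0 v] at k
    calc _ ≤ _ := k
      _ ≤ 35 * κ ^ 8 * (T ^ 3 / (L : ℝ) ^ 2) * (5 * (n : ℝ) ^ 2 * ‖v‖) := by
          gcongr; exact hsum v
      _ = _ := by ring
  · have k := (key v).2.2.2
    rw [hU0 v] at k
    calc _ ≤ _ := k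
      _ ≤ 25 * κ ^ 8 * (T ^ 3 / (L : ℝ) ^ 2) * (5 * (n : ℝ) ^ 2 * ‖v‖) := by
          gcongr; exact hsum v
      _ = _ := by ring

theorem vector_error_le
    (h : CommutatorBounds (Matrix.toEuclideanCLM (𝕜 := ℂ) (fdLaplacian n))
      (Matrix.toEuclideanCLM (𝕜 := ℂ) (fdPotential n V)) D κ)
    (hg₁ : ControlBounds g₁ T κ) (hg₂ : ControlBounds g₂ T κ)
    (e₁ : Set.EqOn f₁ g₁ (Set.Icc 0 T)) (e₂ : Set.EqOn f₂ g₂ (Set.Icc 0 T)) (hT : 0 < T) {L : ℕ}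
    (hL : T ≤ L) {φ : ℝ → ℝ → ℂ} {ψ : ℝ → Fin n → ℂ} (hφ : IsExactSolution f₁ f₂ V T φ)
    (hψ : SolvesODE (hamiltonian f₁ f₂ (fdLaplacian n) (fdPotential n V)) T ψ)
    (h0 : ψ 0 = sample n (φ 0)) {S₄ S₂ S₀ : ℝ} (hS₄ : S₄ = supDeriv 4 T φ)
    (hS₂ : S₂ = supDeriv 2 T φ) (hS₀ : S₀ = supUnit (φ 0)) :
    starNorm ((numEvolution (stepS1 f₁ f₂ (fdLaplacian n) (fdPotential n V)) T L).mulVec (ψ 0)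
        - ψ T) ≤ 80 * κ ^ 8 * (T ^ 2 / L) * ((T + 1) * S₄ + S₂ + S₀) ∧
      starNorm ((numEvolution (stepG1 f₁ f₂ (fdLaplacian n) (fdPotential n V)) T L).mulVec (ψ 0)
        - ψ T) ≤ 32 * κ ^ 8 * (T ^ 2 / L) * (√((T + 1) * S₄ + S₂) * √S₀ + S₀) ∧
      starNorm ((numEvolution (stepS2 f₁ f₂ (fdLaplacian n) (fdPotential n V)) T L).mulVec (ψ 0)
        - ψ T) ≤ 280 * κ ^ 9 * (T ^ 3 / (L : ℝ) ^ 2) * ((T + 1) * S₄ + S₂ + S₀) ∧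
      starNorm ((numEvolution (stepG2 f₁ f₂ (fdLaplacian n) (fdPotential n V)) T L).mulVec (ψ 0)
        - ψ T) ≤ 200 * κ ^ 9 * (T ^ 3 / (L : ℝ) ^ 2) * ((T + 1) * S₄ + S₂ + S₀) := by
  have hκ1 := h.one_le
  have hκ : 0 ≤ κ := zero_le_one.trans hκ1
  have hn : (0 : ℝ) < n := Nat.cast_pos.2 (NeZero.pos n)
  have hsn : 0 < √(n : ℝ) := Real.sqrt_pos.2 hn
  have h00 : (0 : ℝ) ∈ Set.Icc 0 T := ⟨le_rfl, hT.le⟩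
  have hS₄0 : 0 ≤ S₄ :=
    hS₄ ▸ (norm_nonneg _).trans (hφ.norm_iteratedDeriv_le hφ.bdd_four h00 0)
  have hS₂0 : 0 ≤ S₂ :=
    hS₂ ▸ (norm_nonneg _).trans (hφ.norm_iteratedDeriv_le hφ.bdd_two h00 0)
  have hbdd : BddAbove ((fun y => ‖φ 0 y‖) '' Set.Icc 0 1) :=
    isCompact_Icc.bddAbove_image (hφ.contDiff 0 h00).continuous.norm.continuousOn
  have hS₀le : ∀ y ∈ Set.Icc (0 : ℝ) 1, ‖φ 0 y‖ ≤ S₀ := fun y hy =>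
    hS₀ ▸ le_csSup hbdd ⟨y, hy, rfl⟩
  have hS₀0 : 0 ≤ S₀ := (norm_nonneg _).trans (hS₀le 0 ⟨le_rfl, zero_le_one⟩)
  have hψ0 : ‖WithLp.toLp 2 (ψ 0)‖ ≤ √(n : ℝ) * S₀ := by
    rw [h0]
    refine norm_toLp_le hS₀0 fun k => hS₀le _ ⟨by positivity, ?_⟩
    exact div_le_one_of_le₀ (by exact_mod_cast k.2.le) hn.le
  set P := 2 * S₂ + 8 * κ * T * S₄ with hP
  set Q := (T + 1) * S₄ + S₂ with hQ
  have hP0 : 0 ≤ P := by positivity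
  have hQ0 : 0 ≤ Q := by positivity
  -- The constant 8 comes from the term `8 κ T S₄`; it multiplies all constants of the global
  -- estimate.
  have hPQ : P ≤ 8 * κ * Q := by
    have := mul_nonneg hκ hS₄0
    have := mul_le_mul_of_nonneg_right hκ1 hS₂0
    rw [hP, hQ]
    nlinarith
  have hf₁ : ∀ t ∈ Set.Icc 0 T, |f₁ t| ≤ κ := fun t ht => by rw [e₁ ht]; exact hg₁.abs_le t
  have key := norm_numEvolution_sub_le_all (a := √(n : ℝ) * P) (s := √(n : ℝ) * S₀)
    h hg₁ hg₂ e₁ e₂ hT hL (ψ := fun t => WithLp.toLp 2 (ψ t))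
    (fun t ht => by
      rw [Matrix.toEuclideanCLM_toLp, ← WithLp.toLp_smul]
      exact hasDerivWithinAt_toLp (hψ t ht))
    (fun t ht => by
      rw [hP, hS₂, hS₄]
      exact norm_fdLaplacian_solution_le hT.le hf₁ hφ h.selfAdjoint_left h.selfAdjoint_right hψ
        h0 ht) hψ0
  have hstar : ∀ {X : Matrix (Fin n) (Fin n) ℂ} {b c : ℝ},
      ‖Matrix.toEuclideanCLM (𝕜 := ℂ) X (WithLp.toLp 2 (ψ 0)) - WithLp.toLp 2 (ψ T)‖ ≤ c →
        c ≤ √(n : ℝ) * b → starNorm (X.mulVec (ψ 0) - ψ T) ≤ b := fun hX hcb => by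
    rw [starNorm, div_le_iff₀' hsn, WithLp.toLp_sub, ← Matrix.toEuclideanCLM_toLp]
    exact hX.trans hcb
  have hsum : P + S₀ ≤ 8 * κ * (Q + S₀) := by nlinarith [mul_le_mul_of_nonneg_right hκ1 hS₀0]
  have hsqrt : √(√(n : ℝ) * P * (√(n : ℝ) * S₀)) + √(n : ℝ) * S₀ ≤
      √(n : ℝ) * (8 * κ * (√Q * √S₀ + S₀)) := by
    have i1 : √(n : ℝ) * P * (√(n : ℝ) * S₀) ≤ (√(n : ℝ) * (8 * κ) * (√Q * √S₀)) ^ 2 := by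
      have e : (√(n : ℝ) * (8 * κ) * (√Q * √S₀)) ^ 2 =
          √(n : ℝ) * (8 * κ * (8 * κ * Q)) * (√(n : ℝ) * S₀) := by
        rw [mul_pow, mul_pow, mul_pow √Q, Real.sq_sqrt hQ0, Real.sq_sqrt hS₀0]
        ring
      rw [e]
      gcongr
      nlinarith
    have i2 := Real.sqrt_le_iff.2 ⟨by positivity, i1⟩
    have i3 : S₀ ≤ 8 * κ * S₀ := by nlinarith [mul_le_mul_of_nonneg_right hκ1 hS₀0]
    calc _ ≤ √(n : ℝ) * (8 * κ) * (√Q * √S₀) + √(n : ℝ) * (8 * κ * S₀) := by gcongr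
      _ = _ := by ring
  refine ⟨hstar key.1 ?_, hstar key.2.1 ?_, hstar key.2.2.1 ?_, hstar key.2.2.2 ?_⟩
  · calc _ = 10 * κ ^ 7 * (T ^ 2 / L) * √(n : ℝ) * (P + S₀) := by ring
      _ ≤ 10 * κ ^ 7 * (T ^ 2 / L) * √(n : ℝ) * (8 * κ * (Q + S₀)) := by gcongr
      _ = _ := by ring
  · calc _ ≤ 4 * κ ^ 7 * (T ^ 2 / L) * (√(n : ℝ) * (8 * κ * (√Q * √S₀ + S₀))) := by gcongr
      _ = _ := by ring
  · calc _ = 35 * κ ^ 8 * (T ^ 3 / (L : ℝ) ^ 2) * √(n : ℝ) * (P + S₀) := by ring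
      _ ≤ 35 * κ ^ 8 * (T ^ 3 / (L : ℝ) ^ 2) * √(n : ℝ) * (8 * κ * (Q + S₀)) := by gcongr
      _ = _ := by ring
  · calc _ = 25 * κ ^ 8 * (T ^ 3 / (L : ℝ) ^ 2) * √(n : ℝ) * (P + S₀) := by ring
      _ ≤ 25 * κ ^ 8 * (T ^ 3 / (L : ℝ) ^ 2) * √(n : ℝ) * (8 * κ * (Q + S₀)) := by gcongr
      _ = _ := by ring

end Errors

end TrotterFD

/-! ### Choice of constants and conclusion. -/

theorem mainTheorem7 (m K : ℝ) (hm : 0 < m) (hK : 0 < K) :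
    ∃ C c : ℝ, 0 < C ∧ 0 < c ∧
      ∀ (T : ℝ) (_ : 0 < T) (M ω V : ℝ → ℝ)
        (_ : ∀ t ∈ Set.Icc 0 T, m ≤ M t)
        (_ : TrotterFD.BoundedC2 K T M) (_ : TrotterFD.BoundedC2 K T ω)
        (_ : TrotterFD.BoundedPeriodicC4 K V)
        (n : ℕ) [NeZero n] (L : ℕ) (_ : c * T ≤ (L : ℝ))
        (f₁ f₂ : ℝ → ℝ) (_ : f₁ = TrotterFD.kineticControl M)
        (_ : f₂ = TrotterFD.potentialControl M ω)
        (H₁ H₂ Us1 Ug1 Us2 Ug2 : Matrix (Fin n) (Fin n) ℂ)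
        (_ : H₁ = TrotterFD.fdLaplacian n) (_ : H₂ = TrotterFD.fdPotential n V)
        (_ : Us1 = TrotterFD.numEvolution (TrotterFD.stepS1 f₁ f₂ H₁ H₂) T L)
        (_ : Ug1 = TrotterFD.numEvolution (TrotterFD.stepG1 f₁ f₂ H₁ H₂) T L)
        (_ : Us2 = TrotterFD.numEvolution (TrotterFD.stepS2 f₁ f₂ H₁ H₂) T L)
        (_ : Ug2 = TrotterFD.numEvolution (TrotterFD.stepG2 f₁ f₂ H₁ H₂) T L),
        (∀ U : ℝ → Matrix (Fin n) (Fin n) ℂ,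
          TrotterFD.IsEvolution (TrotterFD.hamiltonian f₁ f₂ H₁ H₂) T U →
            ‖Us1 - U T‖ ≤ C * ((n : ℝ) ^ 2 * T ^ 2 / L) ∧
            ‖Ug1 - U T‖ ≤ C * ((n : ℝ) * T ^ 2 / L) ∧
            ‖Us2 - U T‖ ≤ C * ((n : ℝ) ^ 2 * T ^ 3 / (L : ℝ) ^ 2) ∧
            ‖Ug2 - U T‖ ≤ C * ((n : ℝ) ^ 2 * T ^ 3 / (L : ℝ) ^ 2)) ∧
        (∀ (φ : ℝ → ℝ → ℂ) (ψ : ℝ → Fin n → ℂ),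
          TrotterFD.IsExactSolution f₁ f₂ V T φ →
          TrotterFD.SolvesODE (TrotterFD.hamiltonian f₁ f₂ H₁ H₂) T ψ →
          ψ 0 = TrotterFD.sample n (φ 0) →
          ∀ S₄ S₂ S₀ : ℝ, S₄ = TrotterFD.supDeriv 4 T φ → S₂ = TrotterFD.supDeriv 2 T φ →
            S₀ = TrotterFD.supUnit (φ 0) →
            TrotterFD.starNorm (Us1.mulVec (ψ 0) - ψ T)
              ≤ C * (T ^ 2 / L) * ((T + 1) * S₄ + S₂ + S₀) ∧
            TrotterFD.starNorm (Ug1.mulVec (ψ 0) - ψ T)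
              ≤ C * (T ^ 2 / L) * (√((T + 1) * S₄ + S₂) * √S₀ + S₀) ∧
            TrotterFD.starNorm (Us2.mulVec (ψ 0) - ψ T)
              ≤ C * (T ^ 3 / (L : ℝ) ^ 2) * ((T + 1) * S₄ + S₂ + S₀) ∧
            TrotterFD.starNorm (Ug2.mulVec (ψ 0) - ψ T)
              ≤ C * (T ^ 3 / (L : ℝ) ^ 2) * ((T + 1) * S₄ + S₂ + S₀)) := by
  obtain ⟨κ₀, hκ₀⟩ := TrotterFD.exists_smoothControl hm hK
  -- One constant serves the commutators (`1`, `8 K`, `2 K²`) and the controls (`κ₀`).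
  set κ := max (max 1 (8 * K)) (max (2 * K ^ 2) κ₀)
  have k1 : 1 ≤ κ := (le_max_left _ _).trans (le_max_left _ _)
  have k2 : 8 * K ≤ κ := (le_max_right _ _).trans (le_max_left _ _)
  have k3 : 2 * K ^ 2 ≤ κ := (le_max_left _ _).trans (le_max_right _ _)
  have k4 : κ₀ ≤ κ := (le_max_right _ _).trans (le_max_right _ _)
  have k0 : 0 < κ := zero_lt_one.trans_le k1
  -- `280 κ⁹` dominates all eight constants, the largest being that of the standard second-order
  -- scheme in the vector norm. The choice `c = 1` means step length at most one.
  refine ⟨280 * κ ^ 9, 1, by positivity, one_pos, ?_⟩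
  intro T hT M ω V hMm hM hω hV n _ L hL f₁ f₂ hf₁ hf₂ H₁ H₂ Us1 Ug1 Us2 Ug2 hH₁ hH₂ hs1 hg1 hs2 hg2
  subst hf₁ hf₂ hH₁ hH₂ hs1 hg1 hs2 hg2
  rw [one_mul] at hL
  obtain ⟨⟨d₁, hd₁⟩, d₂, hd₂⟩ := hκ₀ T hT M ω hMm hM hω
  have h := TrotterFD.commutatorBounds_fd (n := n) hV hK.le k1 k2 k3
  have c₁ := (hd₁.mono k4).controlBounds hT.le k0.le
  have c₂ := (hd₂.mono k4).controlBounds hT.le k0.le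
  have e₁ : Set.EqOn (TrotterFD.kineticControl M)
      (fun x => TrotterFD.kineticControl M (Set.projIcc 0 T hT.le x)) (Set.Icc 0 T) :=
    fun x hx => by simp only [Set.projIcc_of_mem hT.le hx]
  have e₂ : Set.EqOn (TrotterFD.potentialControl M ω)
      (fun x => TrotterFD.potentialControl M ω (Set.projIcc 0 T hT.le x)) (Set.Icc 0 T) :=
    fun x hx => by simp only [Set.projIcc_of_mem hT.le hx]
  have p7 : κ ^ 7 ≤ κ ^ 9 := pow_le_pow_right₀ k1 (by norm_num)
  have p8 : κ ^ 8 ≤ κ ^ 9 := pow_le_pow_right₀ k1 (by norm_num)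
  have p9 : 0 < κ ^ 9 := by positivity
  refine ⟨fun U hU => ?_, fun φ ψ hφ hψ h0 S₄ S₂ S₀ hS₄ hS₂ hS₀ => ?_⟩
  · obtain ⟨q1, q2, q3, q4⟩ := TrotterFD.operator_error_le h c₁ c₂ e₁ e₂ hT hL hU
    refine ⟨q1.trans ?_, q2.trans ?_, q3.trans ?_, q4.trans ?_⟩ <;>
      exact mul_le_mul_of_nonneg_right (by linarith) (by positivity)
  · have h00 : (0 : ℝ) ∈ Set.Icc 0 T := ⟨le_rfl, hT.le⟩
    have hS₄0 : 0 ≤ S₄ :=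
      hS₄ ▸ (norm_nonneg _).trans (hφ.norm_iteratedDeriv_le hφ.bdd_four h00 0)
    have hS₂0 : 0 ≤ S₂ :=
      hS₂ ▸ (norm_nonneg _).trans (hφ.norm_iteratedDeriv_le hφ.bdd_two h00 0)
    have hS₀0 : 0 ≤ S₀ := hS₀ ▸ Real.sSup_nonneg (by rintro _ ⟨y, -, rfl⟩; exact norm_nonneg _)
    obtain ⟨q1, q2, q3, q4⟩ :=
      TrotterFD.vector_error_le h c₁ c₂ e₁ e₂ hT hL hφ hψ h0 hS₄ hS₂ hS₀
    refine ⟨q1.trans ?_, q2.trans ?_, q3.trans ?_, q4.trans ?_⟩ <;>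
      exact mul_le_mul_of_nonneg_right
        (mul_le_mul_of_nonneg_right (by linarith) (by positivity)) (by positivity)
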